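/- Let \(X\) be a non-empty regular Hausdorff space. Conventions: * \(\mathsf S_1(\mathcal A,\mathcal B)\): for every sequence \(\langle A_n\rangle_{n\in\omega}\) in \(\mathcal A\) there are \(x_n\in A_n\) with \(\{x_n:n\in\omega\}\in\mathcal B\). In the game \(\mathsf G_1(\mathcal A,\mathcal B)\), in inning \(n\in\omega\) One plays \(A_n\in\mathcal A\) and Two answers with \(x_n\in A_n\); Two wins if \(\{x_n:n\in\omega\}\in\mathcal B\), otherwise One wins. Strategies use full information; a Markov strategy for Two depends only on the latest move of One and on the inning number. \(\neg\mathcal B\) is the complement of \(\mathcal B\). * For a space \(Y\): \(\mathscr T_Y\) is the family of proper non-empty open sets; \(\mathscr N_{Y,y}=\{U\in\mathscr T_Y:y\in U\}\); \(\mathscr N_Y(A)=\{U\in\mathscr T_Y:A\subseteq U\}\), \(\mathscr N_Y[\mathcal A]=\{\mathscr N_Y(A):A\in\mathcal A\}\); \(\mathrm{CD}_Y\) is the family of closed discrete sets, \(\mathscr D_Y\) that of dense sets, \(\Omega_{Y,y}=\{A\subseteq Y:y\in\mathrm{cl}(A)\}\); \(\mathcal O_Y\) is the family of open covers \(\mathscr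 U\) of \(Y\) with \(\emptyset,Y\notin\mathscr U\). * \([X]^{<\omega}\) and \(K(X)\) are the families of non-empty finite and of non-empty compact subsets of \(X\). \(\Omega_X\) (resp. \(\mathcal K_X\)) is the set of those \(\mathscr U\in\mathcal O_X\) such that every member of \([X]^{<\omega}\) (resp. \(K(X)\)) is contained in a member of \(\mathscr U\). \(Y\) is Rothberger if \(\mathsf S_1(\mathcal O_Y,\mathcal O_Y)\); \(X\) is \(\omega\)-Rothberger if \(\mathsf S_1(\Omega_X,\Omega_X)\) and \(k\)-Rothberger if \(\mathsf S_1(\mathcal K_X,\mathcal K_X)\). \(Y\) has strong countable (dense) fan-tightness at \(y\) if \(\mathsf S_1(\Omega_{Y,y},\Omega_{Y,y})\) (resp. \(\mathsf S_1(\mathscr D_Y,\Omega_{Y,y})\)). * A cusco map from \(X\) to \(\mathbb R\) is an upper semicontinuous set-valued map with non-empty compact convex values; it is minimal if its graph is minimal under inclusion among graphs of cusco maps. \(\mathrm{MC}_p(X)\) (resp. \(\mathrm{MC}_k(X)\)) is the set of minimal cusco maps from \(X\) to \(\mathbb R\) with the topology of uniform convergence, with respect to the Hausdorff distance, on the members of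 \([X]^{<\omega}\) (resp. \(K(X)\)). \(\mathbf 0\) is the map constantly equal to \(\{0\}\). (A) The following are equivalent. 1. \(X\) is \(\omega\)-Rothberger. 2. \(X^{<\omega}\), the disjoint union of the powers \(X^n\), \(n\ge 1\), is Rothberger. 3. \(\mathcal P_{\mathrm{fin}}(X)\), the set \([X]^{<\omega}\) with the Vietoris topology (as a subspace of the hyperspace of non-empty compact sets), is Rothberger. 4. One has no winning strategy in \(\mathsf G_1(\Omega_X,\Omega_X)\). 5. \(\mathrm{MC}_p(X)\) has strong countable fan-tightness at \(\mathbf 0\). 6. \(\mathrm{MC}_p(X)\) has strong countable dense fan-tightness at \(\mathbf 0\). 7. Two has no winning Markov strategy in \(\mathsf G_1(\mathscr N_X[[X]^{<\omega}],\neg\Omega_X)\). 8. Two has no winning strategy in \(\mathsf G_1(\mathscr N_X[[X]^{<\omega}],\neg\Omega_X)\). 9. Two has no winning Markov strategy in \(\mathsf G_1(\mathscr T_{\mathrm{MC}_p(X)},\mathrm{CD}_{\mathrm{MC}_p(X)})\). 10. Two has no winning strategy in \(\mathsf G_1(\mathscr T_{\mathrm{MC}_p(X)},\mathrm{CD}_{\mathrm{MC}_p(X)})\).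 11. Two has no winning Markov strategy in \(\mathsf G_1(\mathscr N_{\mathrm{MC}_p(X),\mathbf 0},\neg\Omega_{\mathrm{MC}_p(X),\mathbf 0})\). 12. Two has no winning strategy in \(\mathsf G_1(\mathscr N_{\mathrm{MC}_p(X),\mathbf 0},\neg\Omega_{\mathrm{MC}_p(X),\mathbf 0})\). (B) The following are equivalent. 1. \(X\) is \(k\)-Rothberger. 2. One has no winning strategy in \(\mathsf G_1(\mathcal K_X,\mathcal K_X)\). 3. \(\mathrm{MC}_k(X)\) has strong countable fan-tightness at \(\mathbf 0\). 4. \(\mathrm{MC}_k(X)\) has strong countable dense fan-tightness at \(\mathbf 0\). 5. Two has no winning Markov strategy in \(\mathsf G_1(\mathscr N_X[K(X)],\neg\mathcal K_X)\). 6. Two has no winning strategy in \(\mathsf G_1(\mathscr N_X[K(X)],\neg\mathcal K_X)\). 7. Two has no winning Markov strategy in \(\mathsf G_1(\mathscr T_{\mathrm{MC}_k(X)},\mathrm{CD}_{\mathrm{MC}_k(X)})\). 8. Two has no winning strategy in \(\mathsf G_1(\mathscr T_{\mathrm{MC}_k(X)},\mathrm{CD}_{\mathrm{MC}_k(X)})\).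 9. Two has no winning Markov strategy in \(\mathsf G_1(\mathscr N_{\mathrm{MC}_k(X),\mathbf 0},\neg\Omega_{\mathrm{MC}_k(X),\mathbf 0})\). 10. Two has no winning strategy in \(\mathsf G_1(\mathscr N_{\mathrm{MC}_k(X),\mathbf 0},\neg\Omega_{\mathrm{MC}_k(X),\mathbf 0})\). -/

import Mathlib

open Set Topology TopologicalSpace

namespace SelectionGame

/-! ### Selection principles and single-selection games -/

section Games

variable {α : Type*}

/-- The selection principle `S₁(𝒜, ℬ)`. -/
def S1 (𝒜 ℬ : Set (Set α)) : Prop :=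
  ∀ A : ℕ → Set α, (∀ n, A n ∈ 𝒜) → ∃ x : ℕ → α, (∀ n, x n ∈ A n) ∧ range x ∈ ℬ

/-- `I ↑ G₁(𝒜, ℬ)`: One has a winning strategy. In inning `n` One sees `⟨x 0, …, x (n - 1)⟩` and
plays `σ ⟨x 0, …, x (n - 1)⟩ ∈ 𝒜`; Two answers with an element `x n` of that set. -/
def OneWins (𝒜 ℬ : Set (Set α)) : Prop :=
  ∃ σ : List α → Set α,
    (∀ s : List α, (∀ a ∈ s, a ∈ ⋃₀ 𝒜) → σ s ∈ 𝒜) ∧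
    ∀ x : ℕ → α, (∀ n, x n ∈ σ (List.ofFn fun k : Fin n => x k)) → range x ∉ ℬ

/-- `II ↑ G₁(𝒜, ℬ)`: Two has a winning strategy, where Two's answer
`τ ⟨A 0, …, A n⟩` in inning `n` has to be a legal move, that is, an element of `A n`. -/
def TwoWins (𝒜 ℬ : Set (Set α)) : Prop :=
  ∃ τ : List (Set α) → α, ∀ A : ℕ → Set α, (∀ n, A n ∈ 𝒜) →
    (∀ n, τ (List.ofFn fun k : Fin (n + 1) => A k) ∈ A n) ∧
    (range fun n => τ (List.ofFn fun k : Fin (n + 1) => A k)) ∈ ℬ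

/-- Two has a winning Markov strategy in `G₁(𝒜, ℬ)`: Two's (legal) answer depends only on the
most recent move of One and on the number of the inning. -/
def TwoWinsMarkov (𝒜 ℬ : Set (Set α)) : Prop :=
  ∃ τ : Set α → ℕ → α, ∀ A : ℕ → Set α, (∀ n, A n ∈ 𝒜) →
    (∀ n, τ (A n) n ∈ A n) ∧ (range fun n => τ (A n) n) ∈ ℬ

end Games

/-! ### Families attached to a topological space -/

section Families

variable (X : Type*) [TopologicalSpace X]

/-- The non-trivial open covers of `X`: neither `∅` nor `X` is a member. -/
def openCovers : Set (Set (Set X)) :=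
  {𝒰 | (∀ U ∈ 𝒰, IsOpen U) ∧ ⋃₀ 𝒰 = univ ∧ ∅ ∉ 𝒰 ∧ univ ∉ 𝒰}

variable {X} in
/-- The `𝒜`-covers of `X`: non-trivial open covers such that every `A ∈ 𝒜` is contained in a
single member of the cover. -/
def coversOf (𝒜 : Set (Set X)) : Set (Set (Set X)) :=
  {𝒰 | 𝒰 ∈ openCovers X ∧ ∀ A ∈ 𝒜, ∃ U ∈ 𝒰, A ⊆ U}

/-- The non-empty finite subsets of `X`. -/
def finiteSets : Set (Set X) := {A | A.Finite ∧ A.Nonempty}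

/-- The non-empty compact subsets of `X`. -/
def compactSets : Set (Set X) := {A | IsCompact A ∧ A.Nonempty}

/-- The `ω`-covers of `X`. -/
def omegaCovers : Set (Set (Set X)) := coversOf (finiteSets X)

/-- The `k`-covers of `X`. -/
def kCovers : Set (Set (Set X)) := coversOf (compactSets X)

/-- The proper non-empty open subsets of `X`. -/
def properOpens : Set (Set X) := {U | IsOpen U ∧ U.Nonempty ∧ U ≠ univ}

variable {X} in
/-- The proper open neighborhoods of the point `x`. -/
def pointNhds (x : X) : Set (Set X) := {U | U ∈ properOpens X ∧ x ∈ U}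

variable {X} in
/-- `𝒩_X(A)`: the proper non-empty open sets which contain the set `A`. -/
def setNhds (A : Set X) : Set (Set X) := {U | U ∈ properOpens X ∧ A ⊆ U}

variable {X} in
/-- `𝒩_X[𝒜] = {𝒩_X(A) : A ∈ 𝒜}`. -/
def nhdsFamilies (𝒜 : Set (Set X)) : Set (Set (Set X)) := setNhds '' 𝒜

/-- The closed discrete subsets of `X`. -/
def closedDiscrete : Set (Set X) := {D | IsClosed D ∧ IsDiscrete D}

/-- The dense subsets of `X`. -/
def denseSets : Set (Set X) := {D | Dense D}

variable {X} in
/-- `Ω_{X,x}`: the subsets of `X` that have `x` in their closure. -/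
def clusterSets (x : X) : Set (Set X) := {A | x ∈ closure A}

/-- The Rothberger property. -/
def IsRothberger : Prop := S1 (openCovers X) (openCovers X)

/-- The `ω`-Rothberger property. -/
def IsOmegaRothberger : Prop := S1 (omegaCovers X) (omegaCovers X)

/-- The `k`-Rothberger property. -/
def IsKRothberger : Prop := S1 (kCovers X) (kCovers X)

variable {X} in
/-- Strong countable fan-tightness at `x`. -/
def StrongFanTight (x : X) : Prop := S1 (clusterSets x) (clusterSets x)

variable {X} in
/-- Strong countable dense fan-tightness at `x`. -/
def StrongDenseFanTight (x : X) : Prop := S1 (denseSets X) (clusterSets x)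

/-- `X^{<ω}`: the disjoint union of the powers `Xⁿ`, `n ≥ 1`. -/
abbrev FinitePowers (X : Type*) : Type _ := Σ n : ℕ+, (Fin n → X)

/-- `𝒫_fin(X)`: the non-empty finite subsets of `X` as a subspace of the space of non-empty compact
subsets of `X` with the Vietoris topology. -/
abbrev PFin : Type _ := {K : NonemptyCompacts X // (K : Set X).Finite}

end Families

/-! ### Minimal cusco maps -/

section Cusco

variable {X : Type*} [TopologicalSpace X]

/-- The graph of a set-valued map. -/
def graph (Φ : X → NonemptyCompacts ℝ) : Set (X × ℝ) := {p | p.2 ∈ Φ p.1}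

/-- Cusco maps into `ℝ`: upper semicontinuous maps with non-empty compact convex values. -/
def IsCusco (Φ : X → NonemptyCompacts ℝ) : Prop :=
  UpperHemicontinuous (fun x => (Φ x : Set ℝ)) ∧ ∀ x, Convex ℝ (Φ x : Set ℝ)

/-- Cusco maps whose graph is minimal, with respect to inclusion, among the graphs of cusco
maps. -/
def IsMinimalCusco (Φ : X → NonemptyCompacts ℝ) : Prop :=
  IsCusco Φ ∧ ∀ Ψ : X → NonemptyCompacts ℝ, IsCusco Ψ → graph Ψ ⊆ graph Φ → graph Ψ = graph Φ

/-- `MC_𝒜(X)`: the minimal cusco maps from `X` to `ℝ` with the topology of uniform convergence on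
the members of `𝒜`, where the non-empty compact subsets of `ℝ` carry the Hausdorff uniformity. -/
abbrev MC (𝒜 : Set (Set X)) : Type _ :=
  {Φ : UniformOnFun X (NonemptyCompacts ℝ) 𝒜 // IsMinimalCusco (UniformOnFun.toFun 𝒜 Φ)}

variable (X) in
/-- `MC_p(X)`. -/
abbrev MCp : Type _ := MC (finiteSets X)

variable (X) in
/-- `MC_k(X)`. -/
abbrev MCk : Type _ := MC (compactSets X)

theorem isMinimalCusco_zero : IsMinimalCusco (fun _ : X => ({0} : NonemptyCompacts ℝ)) := by
  refine ⟨⟨UpperHemicontinuous.const, fun x => by simp⟩, fun Ψ _ h => h.antisymm ?_⟩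
  rintro ⟨x, y⟩ hy
  obtain ⟨z, hz⟩ := (Ψ x).nonempty
  have h1 : z = 0 := by simpa [graph] using h (show (x, z) ∈ graph Ψ from hz)
  have h2 : y = 0 := by simpa [graph] using hy
  subst h1 h2
  exact hz

/-- The map that is constantly `{0}`. -/
instance (𝒜 : Set (Set X)) : Zero (MC 𝒜) :=
  ⟨⟨UniformOnFun.ofFun 𝒜 fun _ => {0}, isMinimalCusco_zero⟩⟩

end Cusco

end SelectionGame

open SelectionGame

/-!
A family `𝒜` of nonempty compact subsets of `X` that contains the singletons and is closed under
unions is made into a space `UpperVietoris 𝒜`, in which the sets `{A ∈ 𝒜 | A ⊆ U}`, `U` open, form a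
basis. The `𝒜`-covers of `X` are then the covers of this space by basic open sets, so that
`S₁` for `𝒜`-covers is the Rothberger property of `UpperVietoris 𝒜`. No separation is available in
that space, and none is needed: Pawlikowski's theorem (`RothbergerOn.exists_play`) holds for every
Rothberger space, in the form that each strategy of One loses a play in which every point is covered
infinitely often. Its proof uses two facts about a Rothberger space. A tree of increasing open
covers has a branch covering every point infinitely often (`RothbergerOn.exists_branch_of_monotone`,
Hurewicz's theorem on the Menger game); this bounds the answers that have to be considered, so that
only finitely many histories matter in each inning. Moreover, if every point lies in infinitely many
of the sets `⋃₀ 𝒱 n`, then one member of each `𝒱 n` suffices for this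
(`RothbergerOn.exists_frequently_mem`); this picks the answers.

Games that are dual to covering games, or to games on sets clustering at a point, are treated by two
general observations. A sequence without a good selection is a Markov strategy of Two in the dual
game (`TwoWinsMarkov.of_not_S1`), and against a winning strategy of Two in the dual game, One can
play the sets of all its possible answers (`TwoWins.oneWins`).

The passage between `X` and the space `MC 𝒜` of minimal cusco maps has two directions. An answer `Ψ`
near `0` gives the open set of points at which `Ψ` has small values, by upper semicontinuity; thus
Pawlikowski's theorem defeats One at `0` (`MC.not_oneWins_clusterSets`), and the infinitely repeated
covering takes care of all `ε > 0` at once. Conversely, a minimal cusco map can be changed to a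
constant outside a neighborhood of a compact set and remain minimal
(`IsMinimalCusco.exists_eq_on_eq_const`), by Zorn's lemma and regularity. With the constant `1` this
turns `𝒜`-covers into dense sets; with the constant `n` in inning `n`, it gives Two locally finite
answers, as cusco maps are bounded on compact sets.

For finite sets, there are continuous surjections from `X^{<ω}` onto `𝒫_fin(X)` and from there onto
`UpperVietoris (finiteSets X)`. The Rothberger property comes back to `X^{<ω}` because `F ↦ Fᵏ` is
an upper semicontinuous map with finite values (`RothbergerOn.iUnion_of_finite`).
-/

namespace SelectionGame

open Filter

/-! ### Histories -/

/-- The first `n` terms of a sequence as a list, the most recent one first. -/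
def hist {α : Type*} (x : ℕ → α) : ℕ → List α
  | 0 => []
  | n + 1 => x n :: hist x n

theorem length_hist {α : Type*} (x : ℕ → α) (n : ℕ) : (hist x n).length = n := by
  induction n with
  | zero => rfl
  | succ n ih => simp [hist, ih]

theorem reverse_hist {α : Type*} (x : ℕ → α) (n : ℕ) :
    (hist x n).reverse = List.ofFn fun k : Fin n => x k := by
  induction n with
  | zero => rfl
  | succ n ih =>
    rw [List.ofFn_succ', List.concat_eq_append, hist, List.reverse_cons, ih]
    rfl

/-- Every list of elements of a set followed by one more element is an initial segment of a
sequence in this set. -/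
theorem exists_hist_eq {α : Type*} (c : List α) (S : α) :
    ∃ A : ℕ → α, (∀ n, A n ∈ S :: c) ∧ hist A (c.length + 1) = S :: c := by
  refine ⟨fun i => (S :: c).reverse.getD i S, fun n => ?_, ?_⟩
  · change (S :: c).reverse.getD n S ∈ _
    rw [List.getD_eq_getElem?_getD]
    rcases h : (S :: c).reverse[n]? with _ | a
    · simp
    · exact List.mem_reverse.1 (List.mem_of_getElem? h)
  · rw [← List.reverse_inj, reverse_hist]
    refine List.ext_getElem (by simp) fun i h1 h2 => ?_
    rw [List.getElem_ofFn, List.getD_eq_getElem _ _ h2]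

/-- The history of the sequence that is defined by the recursion `x n = pick (hist x n)`. -/
theorem exists_hist_rec {α : Type*} (pick : List α → α) :
    ∃ x : ℕ → α, ∀ n, x n = pick (hist x n) := by
  let h : ℕ → List α := fun n => Nat.rec [] (fun _ s => pick s :: s) n
  have hh : ∀ n, hist (fun n => pick (h n)) n = h n := by
    intro n
    induction n with
    | zero => rfl
    | succ n ih => simp only [hist, ih]; rfl
  exact ⟨fun n => pick (h n), fun n => by rw [hh]⟩

/-! ### Selections from sequences of open covers -/

section Rothberger

/-- The Rothberger property of a subset `S` of a space, for sequences of arbitrary families of open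
sets that cover `S`. As a set is selected from each family, the empty set lacks this property. -/
def RothbergerOn {Y : Type*} [TopologicalSpace Y] (S : Set Y) : Prop :=
  ∀ 𝒲 : ℕ → Set (Set Y), (∀ n, ∀ W ∈ 𝒲 n, IsOpen W) → (∀ n, S ⊆ ⋃₀ 𝒲 n) →
    ∃ W : ℕ → Set Y, (∀ n, W n ∈ 𝒲 n) ∧ S ⊆ ⋃ n, W n

variable {Y : Type*} [TopologicalSpace Y]

/-- Splitting the innings into infinitely many infinite blocks, one can cover `S k` with the
selections from the `k`-th block. -/
theorem exists_selection_pair {S : ℕ → Set Y} (h : ∀ k, RothbergerOn (S k))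
    {𝒲 : ℕ → Set (Set Y)} (ho : ∀ n, ∀ W ∈ 𝒲 n, IsOpen W) (hc : ∀ k n, S k ⊆ ⋃₀ 𝒲 n) :
    ∃ W : ℕ → Set Y, (∀ n, W n ∈ 𝒲 n) ∧ ∀ k, ∀ y ∈ S k, ∃ i, y ∈ W (Nat.pair i k) := by
  choose W hW hS using fun k => h k (fun i => 𝒲 (Nat.pair i k)) (fun i => ho _) (fun i => hc k _)
  refine ⟨fun n => W n.unpair.2 n.unpair.1, fun n => ?_, fun k y hy => ?_⟩
  · simpa using hW n.unpair.2 n.unpair.1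
  · obtain ⟨i, hi⟩ := mem_iUnion.1 (hS k hy)
    exact ⟨i, by simpa using hi⟩

theorem RothbergerOn.iUnion {S : ℕ → Set Y} (h : ∀ k, RothbergerOn (S k)) :
    RothbergerOn (⋃ k, S k) := by
  intro 𝒲 ho hc
  obtain ⟨W, hW, hS⟩ := exists_selection_pair h ho
    (fun k n => (subset_iUnion S k).trans (hc n))
  refine ⟨W, hW, iUnion_subset fun k y hy => ?_⟩
  obtain ⟨i, hi⟩ := hS k y hy
  exact mem_iUnion.2 ⟨_, hi⟩

theorem RothbergerOn.of_surjective {Z : Type*} [TopologicalSpace Z]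
    (h : RothbergerOn (univ : Set Y)) {f : Y → Z} (hf : Continuous f)
    (hs : Function.Surjective f) : RothbergerOn (univ : Set Z) := by
  intro 𝒲 ho hc
  obtain ⟨W, hW, hS⟩ := h (fun n => (f ⁻¹' ·) '' 𝒲 n)
    (by rintro n _ ⟨W, hW, rfl⟩; exact (ho n W hW).preimage hf)
    (by
      intro n y _
      obtain ⟨W, hW, hy⟩ := hc n (mem_univ (f y))
      exact ⟨_, ⟨W, hW, rfl⟩, hy⟩)
  choose V hV hVW using hW
  refine ⟨V, hV, fun z _ => ?_⟩
  obtain ⟨y, rfl⟩ := hs z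
  obtain ⟨n, hn⟩ := mem_iUnion.1 (hS (mem_univ y))
  rw [← hVW] at hn
  exact mem_iUnion.2 ⟨n, hn⟩

/-- For the Rothberger property, the exclusion of `∅` and of the whole space from the covers is
immaterial. -/
theorem isRothberger_iff [Nonempty Y] : IsRothberger Y ↔ RothbergerOn (univ : Set Y) := by
  constructor
  · intro h 𝒲 ho hc
    have hne : ∀ n, (𝒲 n).Nonempty := fun n => by
      obtain ⟨W, hW, -⟩ := hc n (mem_univ (Classical.arbitrary Y))
      exact ⟨W, hW⟩
    by_cases hu : ∃ n, univ ∈ 𝒲 n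
    · obtain ⟨n, hn⟩ := hu
      choose W hW using hne
      refine ⟨Function.update W n univ, fun m => ?_, fun y _ => mem_iUnion.2 ⟨n, by simp⟩⟩
      rcases eq_or_ne m n with rfl | hm
      · simpa using hn
      · simpa [hm] using hW m
    · push Not at hu
      obtain ⟨W, hW, hR⟩ := h (fun n => 𝒲 n \ {∅}) fun n =>
        ⟨fun U hU => ho n U hU.1, by
          refine eq_univ_of_forall fun y => ?_
          obtain ⟨W, hW, hy⟩ := hc n (mem_univ y)
          exact ⟨W, ⟨hW, by rintro rfl; exact hy⟩, hy⟩, by simp, fun hU => hu n hU.1⟩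
      refine ⟨W, fun n => (hW n).1, ?_⟩
      rw [← sUnion_range, hR.2.1]
  · intro h 𝒲 h𝒲
    obtain ⟨W, hW, hS⟩ := h 𝒲 (fun n => (h𝒲 n).1) (fun n => (h𝒲 n).2.1.ge)
    refine ⟨W, hW, ?_, ?_, ?_, ?_⟩
    · rintro _ ⟨n, rfl⟩
      exact (h𝒲 n).1 _ (hW n)
    · rw [sUnion_range]
      exact univ_subset_iff.1 hS
    · rintro ⟨n, hn⟩
      exact (h𝒲 n).2.2.1 (hn ▸ hW n)
    · rintro ⟨n, hn⟩
      exact (h𝒲 n).2.2.2 (hn ▸ hW n)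

/-- If every point lies in infinitely many of the sets `⋃₀ 𝒱 n`, then one set from each `𝒱 n` can be
selected so that every point lies in infinitely many of these. The Rothberger property is applied to
the covers `𝒲 k` whose members are intersections of `k + 1` sets from pairwise different `𝒱 n`; one
of these `k + 1` indices is not taken by any of the preceding `k` selections. -/
theorem RothbergerOn.exists_frequently_mem (h : RothbergerOn (univ : Set Y))
    {𝒱 : ℕ → Set (Set Y)} (ho : ∀ n, ∀ V ∈ 𝒱 n, IsOpen V) (hne : ∀ n, (𝒱 n).Nonempty)
    (hc : ∀ y, ∃ᶠ n in atTop, y ∈ ⋃₀ 𝒱 n) :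
    ∃ V : ℕ → Set Y, (∀ n, V n ∈ 𝒱 n) ∧ ∀ y, ∃ᶠ n in atTop, y ∈ V n := by
  classical
  choose V₀ hV₀ using hne
  let 𝒲 : ℕ → Set (Set Y) := fun k => {W | ∃ (I : Finset ℕ) (V : ℕ → Set Y),
    I.card = k + 1 ∧ (∀ n, V n ∈ 𝒱 n) ∧ W = ⋂ n ∈ I, V n}
  obtain ⟨W, hW, hWc⟩ := exists_selection_pair (S := fun _ => univ) (fun _ => h) (𝒲 := 𝒲)
    (by
      rintro k _ ⟨I, V, -, hV, rfl⟩
      exact isOpen_biInter_finset fun n _ => ho n _ (hV n))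
    (by
      intro _ k y _
      obtain ⟨I, hI, hIk⟩ :=
        (Nat.frequently_atTop_iff_infinite.1 (hc y)).exists_subset_card_eq (k + 1)
      choose! V hV hyV using fun n (hn : y ∈ ⋃₀ 𝒱 n) => mem_sUnion.1 hn
      refine ⟨_, ⟨I, fun n => if y ∈ ⋃₀ 𝒱 n then V n else V₀ n, hIk, fun n => ?_, rfl⟩, ?_⟩
      · dsimp only
        split_ifs with hn
        · exact hV n hn
        · exact hV₀ n
      · refine mem_iInter₂.2 fun n hn => ?_
        have hn' : y ∈ ⋃₀ 𝒱 n := hI hn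
        change y ∈ if y ∈ ⋃₀ 𝒱 n then V n else V₀ n
        rw [if_pos hn']
        exact hyV n hn')
  choose I V hI hV hWV using hW
  -- Hall's theorem provides pairwise different indices `e k ∈ I k`.
  obtain ⟨e, he, heI⟩ := (Finset.all_card_le_biUnion_card_iff_exists_injective I).1 (by
    intro s
    rcases s.eq_empty_or_nonempty with rfl | hs
    · simp
    · calc s.card ≤ (Finset.range (s.max' hs + 1)).card :=
            Finset.card_le_card fun k hk => Finset.mem_range_succ_iff.2 (s.le_max' k hk)
        _ = (I (s.max' hs)).card := by rw [Finset.card_range, hI]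
        _ ≤ _ := Finset.card_le_card (Finset.subset_biUnion_of_mem I (s.max'_mem hs)))
  refine ⟨fun n => if hn : ∃ k, e k = n then V hn.choose n else V₀ n, fun n => ?_, fun y => ?_⟩
  · dsimp only
    split_ifs with hn
    · exact hV _ n
    · exact hV₀ n
  · rw [Nat.frequently_atTop_iff_infinite]
    have hinf : {k | y ∈ W k}.Infinite := by
      choose i hi using fun j => hWc j y (mem_univ y)
      refine infinite_of_injective_forall_mem (f := fun j => Nat.pair (i j) j) ?_ hi
      intro j j' hj
      simpa using congrArg (fun n => n.unpair.2) hj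
    refine (hinf.image he.injOn).mono ?_
    rintro _ ⟨k, hk, rfl⟩
    have hex : ∃ k', e k' = e k := ⟨k, rfl⟩
    have hch : hex.choose = k := he hex.choose_spec
    change y ∈ if hn : ∃ k', e k' = e k then V hn.choose (e k) else V₀ (e k)
    rw [dif_pos hex, hch]
    rw [mem_ofPred_eq, hWV] at hk
    exact mem_iInter₂.1 hk _ (heI k)

end Rothberger

/-! ### Branches through trees of open covers -/

section Trees

variable {Y : Type*}

/-- The union of the sets `U t`, over the nonempty final segments `t` of `s` whose head is at
least `j`. -/
def accumulated (U : List ℕ → Set Y) (j : ℕ) : List ℕ → Set Y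
  | [] => ∅
  | m :: s => accumulated U j s ∪ {y | j ≤ m ∧ y ∈ U (m :: s)}

theorem exists_of_mem_accumulated_hist {U : List ℕ → Set Y} {j : ℕ} {f : ℕ → ℕ} {y : Y} {n : ℕ}
    (h : y ∈ accumulated U j (hist f n)) : ∃ k, j ≤ f k ∧ y ∈ U (hist f (k + 1)) := by
  induction n with
  | zero => exact h.elim
  | succ n ih =>
    rcases h with h | h
    · exact ih h
    · exact ⟨n, h⟩

variable [TopologicalSpace Y]

/-- On each level of a tree of increasing open covers, every point has a neighborhood that is
contained in all but finitely many of the sets `accumulated U j s`. -/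
theorem exists_finset_mem_interior_accumulated {U : List ℕ → Set Y} (ho : ∀ s, IsOpen (U s))
    (hm : ∀ s, Monotone fun m => U (m :: s)) (hc : ∀ s y, ∃ m, y ∈ U (m :: s)) (j n : ℕ) (y : Y) :
    ∃ F : Finset (List ℕ), y ∈ interior (⋂ s ∈ {s : List ℕ | s.length = n ∧ s ∉ F},
      accumulated U j s) := by
  classical
  induction n with
  | zero =>
    refine ⟨{[]}, ?_⟩
    have : {s : List ℕ | s.length = 0 ∧ s ∉ ({[]} : Finset (List ℕ))} = ∅ := by
      ext s
      simp
    rw [this]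
    simp
  | succ n ih =>
    obtain ⟨F, hF⟩ := ih
    choose M hM using hc
    let M' : List ℕ → ℕ := fun s => max j (M s y)
    refine ⟨F.biUnion fun s => (Finset.range (M' s)).image (· :: s), ?_⟩
    refine mem_interior.2 ⟨interior (⋂ s ∈ {s : List ℕ | s.length = n ∧ s ∉ F},
      accumulated U j s) ∩ ⋂ s ∈ F, U (M' s :: s), ?_,
      isOpen_interior.inter (isOpen_biInter_finset fun s _ => ho _), hF, ?_⟩
    · rintro z ⟨hz1, hz2⟩
      refine mem_iInter₂.2 ?_
      rintro (_ | ⟨m, s⟩) ⟨hl, hs⟩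
      · simp at hl
      · by_cases hsF : s ∈ F
        · have hmM : M' s ≤ m := by
            by_contra hlt
            exact hs (Finset.mem_biUnion.2 ⟨s, hsF, Finset.mem_image.2
              ⟨m, Finset.mem_range.2 (not_le.1 hlt), rfl⟩⟩)
          exact Or.inr ⟨(le_max_left _ _).trans hmM, hm s hmM (mem_iInter₂.1 hz2 s hsF)⟩
        · exact Or.inl (mem_iInter₂.1 (interior_subset hz1) s ⟨by simpa using hl, hsF⟩)
    · exact mem_iInter₂.2 fun s _ => hm s (le_max_right _ _) (hM s y)

/-- Hurewicz's theorem on the Menger game, for increasing covers: a tree of increasing open covers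
has a branch that covers every point infinitely often. -/
theorem RothbergerOn.exists_branch_of_monotone (h : RothbergerOn (univ : Set Y))
    {U : List ℕ → Set Y} (ho : ∀ s, IsOpen (U s)) (hm : ∀ s, Monotone fun m => U (m :: s))
    (hc : ∀ s y, ∃ m, y ∈ U (m :: s)) :
    ∃ f : ℕ → ℕ, ∀ y, ∃ᶠ n in atTop, y ∈ U (hist f (n + 1)) := by
  classical
  let 𝒲 : ℕ → Set (Set Y) := fun k => range fun F : Finset (List ℕ) =>
    interior (⋂ s ∈ {s : List ℕ | s.length = k + 1 ∧ s ∉ F}, accumulated U k.unpair.2 s)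
  obtain ⟨W, hW, hWc⟩ := exists_selection_pair (S := fun _ => univ) (fun _ => h) (𝒲 := 𝒲)
    (by rintro k _ ⟨F, rfl⟩; exact isOpen_interior)
    (by
      intro _ k y _
      obtain ⟨F, hF⟩ := exists_finset_mem_interior_accumulated ho hm hc k.unpair.2 (k + 1) y
      exact ⟨_, ⟨F, rfl⟩, hF⟩)
  choose F hF using hW
  -- The branch avoids the finite set `F k` on level `k + 1`.
  have hpick : ∀ s : List ℕ, ∃ m, m :: s ∉ F s.length := fun s => by
    obtain ⟨_, ⟨m, rfl⟩, hm⟩ := (infinite_range_of_injective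
      (fun a b hab => (List.cons.inj hab).1 : Function.Injective (· :: s))).exists_notMem_finset
      (F s.length)
    exact ⟨m, hm⟩
  choose pick hpick using hpick
  obtain ⟨f, hf⟩ := exists_hist_rec pick
  refine ⟨f, fun y => ?_⟩
  rw [frequently_atTop]
  intro N
  by_contra! hN
  -- Past the heads of the first `N` nodes, only later nodes can contribute.
  obtain ⟨i, hi⟩ := hWc ((Finset.range N).sup f + 1) y (mem_univ y)
  have hnot : hist f (Nat.pair i ((Finset.range N).sup f + 1) + 1) ∉
      F (Nat.pair i ((Finset.range N).sup f + 1)) := by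
    have := hpick (hist f (Nat.pair i ((Finset.range N).sup f + 1)))
    rw [length_hist, ← hf] at this
    exact this
  rw [← hF] at hi
  have hi' := mem_iInter₂.1 (interior_subset hi) _ ⟨length_hist _ _, hnot⟩
  rw [Nat.unpair_pair] at hi'
  obtain ⟨k, hk, hyk⟩ := exists_of_mem_accumulated_hist hi'
  rcases lt_or_ge k N with hkN | hkN
  · have := Finset.le_sup (f := f) (Finset.mem_range.2 hkN)
    omega
  · exact hN k hkN hyk

/-- The lists of the same length as `t` whose entries are bounded by those of `t`. -/
def box : List ℕ → Finset (List ℕ)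
  | [] => {[]}
  | N :: t => (Finset.range (N + 1) ×ˢ box t).image fun p => p.1 :: p.2

theorem cons_mem_box {N m : ℕ} {t s : List ℕ} (hm : m ≤ N) (hs : s ∈ box t) :
    m :: s ∈ box (N :: t) :=
  Finset.mem_image.2 ⟨(m, s), Finset.mem_product.2 ⟨Finset.mem_range_succ_iff.2 hm, hs⟩, rfl⟩

/-- Pawlikowski's theorem in terms of trees: a tree of countable open covers of a Rothberger space
has a branch that covers every point infinitely often. -/
theorem RothbergerOn.exists_branch (h : RothbergerOn (univ : Set Y))
    {U : List ℕ → Set Y} (ho : ∀ s, IsOpen (U s)) (hc : ∀ s y, ∃ m, y ∈ U (m :: s)) :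
    ∃ g : ℕ → ℕ, ∀ y, ∃ᶠ n in atTop, y ∈ U (hist g (n + 1)) := by
  let B : List ℕ → Set Y
    | [] => univ
    | N :: t => ⋂ s ∈ box t, ⋃ m ≤ N, U (m :: s)
  obtain ⟨f, hf⟩ := h.exists_branch_of_monotone (U := B)
    (by
      rintro (_ | ⟨N, t⟩)
      · exact isOpen_univ
      · exact isOpen_biInter_finset fun s _ => isOpen_biUnion fun m _ => ho _)
    (by
      intro t N N' hN
      exact iInter₂_mono fun s _ => biUnion_subset_biUnion_left fun m hm => le_trans hm hN)
    (by
      intro t y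
      choose m hm using fun s => hc s y
      exact ⟨(box t).sup m, mem_iInter₂.2 fun s hs =>
        mem_iUnion₂.2 ⟨m s, Finset.le_sup hs, hm s⟩⟩)
  -- Within the bounds given by `f`, one function `τ` answers all the finitely many histories.
  let 𝒱 : ℕ → Set (Set Y) := fun n => {V | ∃ τ : List ℕ → ℕ, (∀ s, τ s ≤ f n) ∧
    V = ⋂ s ∈ box (hist f n), U (τ s :: s)}
  obtain ⟨V, hV, hVc⟩ := h.exists_frequently_mem (𝒱 := 𝒱)
    (by
      rintro n _ ⟨τ, -, rfl⟩
      exact isOpen_biInter_finset fun s _ => ho _)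
    (fun n => ⟨_, fun _ => 0, fun _ => Nat.zero_le _, rfl⟩)
    (by
      intro y
      refine (hf y).mono fun n hn => ?_
      choose! τ hτ hyτ using fun s hs => mem_iUnion₂.1 (mem_iInter₂.1 hn s hs)
      refine ⟨_, ⟨fun s => min (τ s) (f n), fun s => min_le_right _ _, rfl⟩, ?_⟩
      refine mem_iInter₂.2 fun s hs => ?_
      change y ∈ U (min (τ s) (f n) :: s)
      rw [min_eq_left (hτ s hs)]
      exact hyτ s hs)
  choose τ hτ hVτ using hV
  obtain ⟨g, hg⟩ := exists_hist_rec fun s => τ s.length s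
  have hg' : ∀ n, g n = τ n (hist g n) := fun n => by
    conv_lhs => rw [hg n, length_hist]
  have hbox : ∀ n, hist g n ∈ box (hist f n) := by
    intro n
    induction n with
    | zero => simp [hist, box]
    | succ n ih => exact cons_mem_box (hg' n ▸ hτ n _) ih
  refine ⟨g, fun y => (hVc y).mono fun n hn => ?_⟩
  rw [hVτ] at hn
  have := mem_iInter₂.1 hn _ (hbox n)
  rwa [← hg'] at this

/-- Pawlikowski's theorem: in a Rothberger space, a strategy `σ` of One that plays open covers
`{G n b : b ∈ σ s}`, where `s` is the list of Two's previous answers in reverse order, is defeated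
by a play in which every point is covered infinitely often. The set `L` contains the legal moves
of Two. -/
theorem RothbergerOn.exists_play (h : RothbergerOn (univ : Set Y)) {β : Type*} {L : Set β}
    (σ : List β → Set β) (G : ℕ → β → Set Y) (hσL : ∀ s, (∀ a ∈ s, a ∈ L) → σ s ⊆ L)
    (ho : ∀ s, (∀ a ∈ s, a ∈ L) → ∀ b ∈ σ s, IsOpen (G s.length b))
    (hc : ∀ s, (∀ a ∈ s, a ∈ L) → ∀ y, ∃ b ∈ σ s, y ∈ G s.length b) :
    ∃ b : ℕ → β, (∀ n, b n ∈ σ (hist b n)) ∧ ∀ y, ∃ᶠ n in atTop, y ∈ G n (b n) := by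
  rcases isEmpty_or_nonempty β with hβ | hβ
  · have hY : IsEmpty Y := ⟨fun y => (hc [] (by simp) y).elim fun b _ => isEmptyElim b⟩
    -- Nothing can be selected from empty families, so a Rothberger space is nonempty.
    obtain ⟨W, hW, -⟩ := h (fun _ => ∅) (by simp) (fun _ y => isEmptyElim y)
    exact (hW 0).elim
  have hcount : ∀ s, (∀ a ∈ s, a ∈ L) → ∃ e : ℕ → β, (∀ m, e m ∈ σ s) ∧
      ∀ y, ∃ m, y ∈ G s.length (e m) := by
    intro s hs
    obtain ⟨W, hW, hWc⟩ := h (fun _ => G s.length '' σ s)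
      (by rintro _ _ ⟨b, hb, rfl⟩; exact ho s hs b hb)
      (fun _ y _ => by
        obtain ⟨b, hb, hy⟩ := hc s hs y
        exact ⟨_, ⟨b, hb, rfl⟩, hy⟩)
    choose e he heW using hW
    refine ⟨e, he, fun y => ?_⟩
    obtain ⟨m, hm⟩ := mem_iUnion.1 (hWc (mem_univ y))
    exact ⟨m, by rwa [heW]⟩
  choose! e he hec using hcount
  let node : List ℕ → List β := fun t => t.rec [] fun m _ s => e s m :: s
  have hnode : ∀ t, ∀ a ∈ node t, a ∈ L := by
    intro t
    induction t with
    | nil => simp [node]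
    | cons m t ih =>
      intro a ha
      rcases List.mem_cons.1 ha with rfl | ha
      · exact hσL _ ih (he _ ih m)
      · exact ih a ha
  have hlen : ∀ t, (node t).length = t.length := by
    intro t
    induction t with
    | nil => rfl
    | cons m t ih => exact congrArg (· + 1) ih
  let U : List ℕ → Set Y
    | [] => univ
    | m :: t => G t.length (e (node t) m)
  obtain ⟨g, hg⟩ := h.exists_branch (U := U)
    (by
      rintro (_ | ⟨m, t⟩)
      · exact isOpen_univ
      · have := ho _ (hnode t) _ (he _ (hnode t) m)
        rwa [hlen] at this)
    (by
      intro t y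
      obtain ⟨m, hm⟩ := hec _ (hnode t) y
      rw [hlen] at hm
      exact ⟨m, hm⟩)
  have hb : ∀ n, hist (fun n => e (node (hist g n)) (g n)) n = node (hist g n) := by
    intro n
    induction n with
    | zero => rfl
    | succ n ih => rw [hist, ih]; rfl
  refine ⟨fun n => e (node (hist g n)) (g n), fun n => ?_, fun y => (hg y).mono fun n hn => ?_⟩
  · rw [hb]
    exact he _ (hnode _) _
  · change y ∈ G (hist g n).length _ at hn
    rwa [length_hist] at hn

end Trees

/-! ### Duality of games -/

section Duality

variable {α : Type*} {𝒜 ℬ R : Set (Set α)}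

theorem S1.of_not_oneWins (h : ¬ OneWins 𝒜 ℬ) : S1 𝒜 ℬ := by
  intro A hA
  by_contra! hno
  refine h ⟨fun s => A s.length, fun s _ => hA _, fun x hx => hno x fun n => ?_⟩
  simpa using hx n

theorem TwoWinsMarkov.twoWins (h : TwoWinsMarkov 𝒜 ℬ) : TwoWins 𝒜 ℬ := by
  obtain ⟨τ, hτ⟩ := h
  rcases isEmpty_or_nonempty α with hα | hα
  · refine ⟨fun s => τ ∅ s.length, fun A hA => isEmptyElim (τ (A 0) 0)⟩
  · refine ⟨fun s => τ (s.getLast?.getD ∅) (s.length - 1), fun A hA => ?_⟩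
    have : ∀ n, τ ((List.ofFn fun k : Fin (n + 1) => A k).getLast?.getD ∅)
        ((List.ofFn fun k : Fin (n + 1) => A k).length - 1) = τ (A n) n := fun n => by
      rw [List.ofFn_succ', List.concat_eq_append]
      simp
    simpa only [this] using hτ A hA

/-- If every member of `𝒜` meets every member of `R`, then a sequence in `𝒜` without a good
selection yields a Markov strategy of Two that answers in these sets. -/
theorem TwoWinsMarkov.of_not_S1 [Nonempty α] (hR : ∀ A ∈ 𝒜, ∀ S ∈ R, (S ∩ A).Nonempty)
    (h : ¬ S1 𝒜 ℬ) : TwoWinsMarkov R ℬᶜ := by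
  classical
  simp only [S1, not_forall, not_exists, not_and] at h
  obtain ⟨A, hA, hno⟩ := h
  have hex : ∀ S n, ∃ x, S ∈ R → x ∈ S ∩ A n := fun S n => by
    by_cases hS : S ∈ R
    · exact (hR _ (hA n) S hS).imp fun x hx _ => hx
    · exact ⟨Classical.arbitrary α, fun h => (hS h).elim⟩
  choose τ hτ using hex
  exact ⟨τ, fun S hS => ⟨fun n => (hτ _ n (hS n)).1, hno _ fun n => (hτ _ n (hS n)).2⟩⟩

/-- If every choice function on `R` has its range in `𝒜`, then One can play the sets of all possible
answers of a winning strategy of Two. -/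
theorem TwoWins.oneWins (hR : ∀ f : Set α → α, (∀ S ∈ R, f S ∈ S) → f '' R ∈ 𝒜)
    (h : TwoWins R ℬᶜ) : OneWins 𝒜 ℬ := by
  classical
  obtain ⟨τ, hτ⟩ := h
  have hleg : ∀ (c : List (Set α)), (∀ A ∈ c, A ∈ R) → ∀ S ∈ R, τ (S :: c).reverse ∈ S := by
    intro c hc S hS
    obtain ⟨A, hA, hAc⟩ := exists_hist_eq c S
    have hAR : ∀ n, A n ∈ R := fun n => by
      rcases List.mem_cons.1 (hA n) with h | h
      · rwa [h]
      · exact hc _ h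
    have h1 := (hτ A hAR).1 c.length
    rw [← reverse_hist, hAc] at h1
    have h2 : A c.length = S := by
      rw [hist] at hAc
      exact (List.cons.inj hAc).1
    rwa [h2] at h1
  let pick : List (Set α) → α → Set α := fun c x =>
    Classical.epsilon fun S => S ∈ R ∧ ((∃ S' ∈ R, τ (S' :: c).reverse = x) → τ (S :: c).reverse = x)
  have hpick : R.Nonempty → ∀ c x, pick c x ∈ R ∧
      ((∃ S' ∈ R, τ (S' :: c).reverse = x) → τ (pick c x :: c).reverse = x) := by
    rintro ⟨S, hS⟩ c x
    refine Classical.epsilon_spec (p := fun S => S ∈ R ∧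
      ((∃ S' ∈ R, τ (S' :: c).reverse = x) → τ (S :: c).reverse = x)) ?_
    by_cases hx : ∃ S' ∈ R, τ (S' :: c).reverse = x
    · obtain ⟨S', hS', hx'⟩ := hx
      exact ⟨S', hS', fun _ => hx'⟩
    · exact ⟨S, hS, fun h => (hx h).elim⟩
  let conv : List α → List (Set α) := fun s => s.rec [] fun x _ c => pick c x :: c
  have hconv : R.Nonempty → ∀ s, ∀ A ∈ conv s, A ∈ R := by
    intro hne s
    induction s with
    | nil => simp [conv]
    | cons x s ih =>
      intro A hA
      rcases List.mem_cons.1 hA with rfl | hA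
      · exact (hpick hne _ _).1
      · exact ih A hA
  refine ⟨fun s => (fun S => τ (S :: conv s.reverse).reverse) '' R,
    fun s _ => hR _ fun S hS => hleg _ (hconv ⟨S, hS⟩ _) S hS, fun x hx => ?_⟩
  have hne : R.Nonempty := by
    obtain ⟨S, hS, -⟩ := hx 0
    exact ⟨S, hS⟩
  have hx' : ∀ n, ∃ S' ∈ R, τ (S' :: conv (hist x n)).reverse = x n := by
    intro n
    obtain ⟨S, hS, hxS⟩ := hx n
    rw [← reverse_hist, List.reverse_reverse] at hxS
    exact ⟨S, hS, hxS⟩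
  let A : ℕ → Set α := fun n => pick (conv (hist x n)) (x n)
  have hA : ∀ n, hist A n = conv (hist x n) := by
    intro n
    induction n with
    | zero => rfl
    | succ n ih => rw [hist, ih]; rfl
  have hAx : ∀ n, τ (List.ofFn fun k : Fin (n + 1) => A k) = x n := by
    intro n
    rw [← reverse_hist, hist, hA]
    exact (hpick hne _ _).2 (hx' n)
  have := (hτ A fun n => (hpick hne _ _).1).2
  simp only [hAx] at this
  exact this

end Duality

/-! ### The upper Vietoris topology -/

/-- A family of nonempty compact sets that contains the singletons and is closed under binary
unions. -/
structure IsCompactBase {X : Type*} [TopologicalSpace X] (𝒜 : Set (Set X)) : Prop where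
  isCompact : ∀ A ∈ 𝒜, IsCompact A
  nonempty : ∀ A ∈ 𝒜, A.Nonempty
  singleton_mem : ∀ x, {x} ∈ 𝒜
  union_mem : ∀ A ∈ 𝒜, ∀ B ∈ 𝒜, A ∪ B ∈ 𝒜

theorem isCompactBase_finiteSets (X : Type*) [TopologicalSpace X] :
    IsCompactBase (finiteSets X) where
  isCompact _ hA := hA.1.isCompact
  nonempty _ hA := hA.2
  singleton_mem x := ⟨finite_singleton x, singleton_nonempty x⟩
  union_mem _ hA _ hB := ⟨hA.1.union hB.1, hA.2.inl⟩

theorem isCompactBase_compactSets (X : Type*) [TopologicalSpace X] :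
    IsCompactBase (compactSets X) where
  isCompact _ hA := hA.1
  nonempty _ hA := hA.2
  singleton_mem x := ⟨isCompact_singleton, singleton_nonempty x⟩
  union_mem _ hA _ hB := ⟨hA.1.union hB.1, hA.2.inl⟩

/-- The family `𝒜` of subsets of `X` as a space, with the upper Vietoris topology: the sets
`{A ∈ 𝒜 | A ⊆ U}`, for `U` open in `X`, form a basis. The `𝒜`-covers of `X` correspond to the covers
of this space by basic open sets. -/
def UpperVietoris {X : Type*} (𝒜 : Set (Set X)) : Type _ := 𝒜

section UpperVietoris

variable {X : Type*} [TopologicalSpace X] {𝒜 : Set (Set X)}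

instance : TopologicalSpace (UpperVietoris 𝒜) where
  IsOpen S := ∀ A ∈ S, ∃ U : Set X, IsOpen U ∧ A.1 ⊆ U ∧ ∀ B : UpperVietoris 𝒜, B.1 ⊆ U → B ∈ S
  isOpen_univ A _ := ⟨univ, isOpen_univ, subset_univ _, fun _ _ => mem_univ _⟩
  isOpen_inter S T hS hT A hA := by
    obtain ⟨U, hU, hAU, h1⟩ := hS A hA.1
    obtain ⟨V, hV, hAV, h2⟩ := hT A hA.2
    exact ⟨U ∩ V, hU.inter hV, subset_inter hAU hAV, fun B hB =>
      ⟨h1 B (hB.trans inter_subset_left), h2 B (hB.trans inter_subset_right)⟩⟩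
  isOpen_sUnion 𝒮 h A := by
    rintro ⟨S, hS, hA⟩
    obtain ⟨U, hU, hAU, h1⟩ := h S hS A hA
    exact ⟨U, hU, hAU, fun B hB => ⟨S, hS, h1 B hB⟩⟩

theorem UpperVietoris.isOpen_setOf_subset {U : Set X} (hU : IsOpen U) :
    IsOpen {A : UpperVietoris 𝒜 | A.1 ⊆ U} :=
  fun _ hA => ⟨U, hU, hA, fun _ hB => hB⟩

theorem range_mem_coversOf (h𝒜 : IsCompactBase 𝒜) {𝒰 : ℕ → Set (Set X)}
    (h𝒰 : ∀ n, 𝒰 n ∈ coversOf 𝒜) {U : ℕ → Set X} (hU : ∀ n, U n ∈ 𝒰 n)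
    (hcov : ∀ A ∈ 𝒜, ∃ n, A ⊆ U n) : range U ∈ coversOf 𝒜 := by
  refine ⟨⟨?_, ?_, ?_, ?_⟩, fun A hA => ?_⟩
  · rintro _ ⟨n, rfl⟩
    exact (h𝒰 n).1.1 _ (hU n)
  · refine eq_univ_of_forall fun x => ?_
    obtain ⟨n, hn⟩ := hcov _ (h𝒜.singleton_mem x)
    exact ⟨_, ⟨n, rfl⟩, hn rfl⟩
  · rintro ⟨n, hn⟩
    exact (h𝒰 n).1.2.2.1 (hn ▸ hU n)
  · rintro ⟨n, hn⟩
    exact (h𝒰 n).1.2.2.2 (hn ▸ hU n)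
  · obtain ⟨n, hn⟩ := hcov A hA
    exact ⟨_, ⟨n, rfl⟩, hn⟩

theorem rothbergerOn_upperVietoris_of_S1 [Nonempty X] (h𝒜 : IsCompactBase 𝒜)
    (h : S1 (coversOf 𝒜) (coversOf 𝒜)) : RothbergerOn (univ : Set (UpperVietoris 𝒜)) := by
  intro 𝒲 ho hc
  have hne : ∀ n, ∃ W, W ∈ 𝒲 n := fun n => by
    obtain ⟨W, hW, -⟩ := hc n (mem_univ ⟨_, h𝒜.singleton_mem (Classical.arbitrary X)⟩)
    exact ⟨W, hW⟩
  let 𝒰 : ℕ → Set (Set X) := fun n =>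
    {U | IsOpen U ∧ U ≠ ∅ ∧ ∃ W ∈ 𝒲 n, ∀ A : UpperVietoris 𝒜, A.1 ⊆ U → A ∈ W}
  by_cases hu : ∃ n, univ ∈ 𝒰 n
  · obtain ⟨n, -, -, W, hW, hAW⟩ := hu
    choose V hV using hne
    refine ⟨Function.update V n W, fun m => ?_, fun A _ => mem_iUnion.2
      ⟨n, by simpa using hAW A (subset_univ _)⟩⟩
    rcases eq_or_ne m n with rfl | hm
    · simpa using hW
    · simpa [hm] using hV m
  · push Not at hu
    have hA𝒰 : ∀ n, ∀ A ∈ 𝒜, ∃ U ∈ 𝒰 n, A ⊆ U := by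
      intro n A hA
      obtain ⟨W, hW, hAW⟩ := hc n (mem_univ ⟨A, hA⟩)
      obtain ⟨U, hU, hAU, hUW⟩ := ho n W hW _ hAW
      exact ⟨U, ⟨hU, ((h𝒜.nonempty A hA).mono hAU).ne_empty, W, hW, hUW⟩, hAU⟩
    obtain ⟨U, hU, hR⟩ := h 𝒰 fun n => ⟨⟨fun U hU => hU.1, by
      refine eq_univ_of_forall fun x => ?_
      obtain ⟨U, hU, hx⟩ := hA𝒰 n _ (h𝒜.singleton_mem x)
      exact ⟨U, hU, hx rfl⟩, fun h => h.2.1 rfl, hu n⟩, hA𝒰 n⟩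
    choose _ _ W hW hUW using hU
    refine ⟨W, hW, fun A _ => ?_⟩
    obtain ⟨_, ⟨n, rfl⟩, hn⟩ := hR.2 A.1 A.2
    exact mem_iUnion.2 ⟨n, hUW n A hn⟩

theorem not_oneWins_coversOf (h𝒜 : IsCompactBase 𝒜)
    (h : RothbergerOn (univ : Set (UpperVietoris 𝒜))) :
    ¬ OneWins (coversOf 𝒜) (coversOf 𝒜) := by
  rintro ⟨σ, hσ, hwin⟩
  have hσ' : ∀ s : List (Set X), (∀ a ∈ s, a ∈ ⋃₀ coversOf 𝒜) → σ s.reverse ∈ coversOf 𝒜 :=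
    fun s hs => hσ _ (by simpa using hs)
  obtain ⟨U, hU, hcov⟩ := h.exists_play (L := ⋃₀ coversOf 𝒜) (fun s => σ s.reverse)
    (fun _ U => {A | A.1 ⊆ U}) (fun s hs U hU => ⟨_, hσ' s hs, hU⟩)
    (fun s hs U hU => UpperVietoris.isOpen_setOf_subset ((hσ' s hs).1.1 U hU))
    (fun s hs A => (hσ' s hs).2 A.1 A.2)
  have hhist : ∀ n, ∀ a ∈ hist U n, a ∈ ⋃₀ coversOf 𝒜 := by
    intro n
    induction n with
    | zero => simp [hist]
    | succ n ih =>
      intro a ha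
      rcases List.mem_cons.1 ha with rfl | ha
      · exact ⟨_, hσ' _ ih, hU n⟩
      · exact ih a ha
  exact hwin U (fun n => by rw [← reverse_hist]; exact hU n)
    (range_mem_coversOf h𝒜 (fun n => hσ' _ (hhist n)) hU fun A hA => (hcov ⟨A, hA⟩).exists)

/-- A winning strategy of Two in the point-open type game makes One win the covering game. -/
theorem oneWins_coversOf (h𝒜 : IsCompactBase 𝒜)
    (h : TwoWins (nhdsFamilies 𝒜) (coversOf 𝒜)ᶜ) : OneWins (coversOf 𝒜) (coversOf 𝒜) := by
  refine h.oneWins fun f hf => ?_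
  have hf' : ∀ A ∈ 𝒜, f (setNhds A) ∈ setNhds A := fun A hA => hf _ ⟨A, hA, rfl⟩
  refine ⟨⟨?_, ?_, ?_, ?_⟩, fun A hA => ⟨_, ⟨_, ⟨A, hA, rfl⟩, rfl⟩, (hf' A hA).2⟩⟩
  · rintro _ ⟨_, ⟨A, hA, rfl⟩, rfl⟩
    exact (hf' A hA).1.1
  · refine eq_univ_of_forall fun x => ?_
    exact ⟨_, ⟨_, ⟨_, h𝒜.singleton_mem x, rfl⟩, rfl⟩, (hf' _ (h𝒜.singleton_mem x)).2 rfl⟩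
  · rintro ⟨_, ⟨A, hA, rfl⟩, h⟩
    exact (hf' A hA).1.2.1.ne_empty h
  · rintro ⟨_, ⟨A, hA, rfl⟩, h⟩
    exact (hf' A hA).1.2.2 h

theorem twoWinsMarkov_nhdsFamilies_of_not_S1
    (h : ¬ S1 (coversOf 𝒜) (coversOf 𝒜)) : TwoWinsMarkov (nhdsFamilies 𝒜) (coversOf 𝒜)ᶜ := by
  refine .of_not_S1 ?_ h
  rintro 𝒰 h𝒰 _ ⟨A, hA, rfl⟩
  obtain ⟨U, hU, hAU⟩ := h𝒰.2 A hA
  refine ⟨U, ⟨⟨h𝒰.1.1 U hU, nonempty_iff_ne_empty.2 ?_, ?_⟩, hAU⟩, hU⟩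
  · rintro rfl
    exact h𝒰.1.2.2.1 hU
  · rintro rfl
    exact h𝒰.1.2.2.2 hU

end UpperVietoris

/-! ### Finite powers -/

section FinitePowers

/-- The Rothberger property passes to the union of the values of an upper semicontinuous map with
finite values. One plays against the selections from the given covers: a move consists of the
points `y` for which `Φ y` is covered by one set from each cover of the next finite block
`a ≤ i < b`, and Two's answer determines these sets. -/
theorem RothbergerOn.iUnion_of_finite {Y Z : Type*} [TopologicalSpace Y] [TopologicalSpace Z]
    (h : RothbergerOn (univ : Set Y)) {Φ : Y → Set Z} (hfin : ∀ y, (Φ y).Finite)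
    (hΦ : ∀ y G, IsOpen G → Φ y ⊆ G → ∀ᶠ y' in 𝓝 y, Φ y' ⊆ G) (hne : (⋃ y, Φ y).Nonempty) :
    RothbergerOn (⋃ y, Φ y) := by
  classical
  intro 𝒲 ho hc
  let start : List (ℕ × ℕ × (ℕ → Set Z)) → ℕ
    | [] => 0
    | b :: _ => b.2.1
  obtain ⟨b, hb, hcov⟩ := h.exists_play (L := univ) (β := ℕ × ℕ × (ℕ → Set Z))
    (fun s => {b | b.1 = start s ∧ b.1 ≤ b.2.1 ∧ ∀ i, b.2.2 i ∈ 𝒲 i})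
    (fun _ b => interior {y | Φ y ⊆ ⋃ i ∈ Ico b.1 b.2.1, b.2.2 i})
    (fun _ _ => subset_univ _) (fun _ _ _ _ => isOpen_interior)
    (by
      intro s _ y
      obtain ⟨e, he⟩ := (countable_iff_exists_injOn.1 (hfin y).countable)
      have hW : ∀ i, ∃ W ∈ 𝒲 i, ∀ z ∈ Φ y, start s + e z = i → z ∈ W := by
        intro i
        by_cases hi : ∃ z ∈ Φ y, start s + e z = i
        · obtain ⟨z, hz, hzi⟩ := hi
          obtain ⟨W, hW, hzW⟩ := hc i (mem_iUnion.2 ⟨y, hz⟩)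
          refine ⟨W, hW, fun z' hz' hzi' => ?_⟩
          rwa [he hz' hz (by omega)]
        · obtain ⟨z, hz⟩ := hne
          obtain ⟨W, hW, -⟩ := hc i hz
          exact ⟨W, hW, fun z hz hzi => (hi ⟨z, hz, hzi⟩).elim⟩
      choose W hW hzW using hW
      refine ⟨(start s, start s + (hfin y).toFinset.sup e + 1, W),
        ⟨rfl, by dsimp only; omega, hW⟩, ?_⟩
      refine mem_interior_iff_mem_nhds.2 (hΦ y _ (isOpen_biUnion fun i _ => ho i _ (hW i)) ?_)
      intro z hz
      have := Finset.le_sup (f := e) ((hfin y).mem_toFinset.2 hz)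
      exact mem_iUnion₂.2 ⟨start s + e z, ⟨by simp, by dsimp only; omega⟩, hzW _ z hz rfl⟩)
  have hstep : ∀ n, (b (n + 1)).1 = (b n).2.1 := fun n => (hb (n + 1)).1
  have hmono : Monotone fun n => (b n).1 := monotone_nat_of_le_succ fun n => by
    rw [hstep]
    exact (hb n).2.1
  -- The blocks are disjoint, so an index determines the inning whose block contains it.
  have huniq : ∀ i n m, i ∈ Ico (b n).1 (b n).2.1 → i ∈ Ico (b m).1 (b m).2.1 → n = m := by
    have hlt : ∀ i n m, n < m → i ∈ Ico (b n).1 (b n).2.1 → i ∉ Ico (b m).1 (b m).2.1 := by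
      intro i n m hnm hn hm
      have h1 : (b (n + 1)).1 ≤ (b m).1 := hmono (Nat.succ_le_of_lt hnm)
      rw [hstep] at h1
      exact absurd (hn.2.trans_le (h1.trans hm.1)) (lt_irrefl _)
    intro i n m hn hm
    rcases lt_trichotomy n m with hnm | hnm | hnm
    · exact (hlt i n m hnm hn hm).elim
    · exact hnm
    · exact (hlt i m n hnm hm hn).elim
  refine ⟨fun i => if hi : ∃ n, i ∈ Ico (b n).1 (b n).2.1 then (b hi.choose).2.2 i
    else (b 0).2.2 i, fun i => ?_, iUnion_subset fun y z hz => ?_⟩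
  · dsimp only
    split_ifs
    · exact (hb _).2.2 i
    · exact (hb 0).2.2 i
  · obtain ⟨n, hn⟩ := (hcov y).exists
    obtain ⟨i, hi, hzi⟩ := mem_iUnion₂.1 (interior_subset hn hz)
    have hex : ∃ n, i ∈ Ico (b n).1 (b n).2.1 := ⟨n, hi⟩
    refine mem_iUnion.2 ⟨i, ?_⟩
    rw [dif_pos hex, huniq i _ n hex.choose_spec hi]
    exact hzi

/-- A tube lemma: a neighborhood of the power `Fᵏ` of a finite set `F` contains the power `Uᵏ` of a
neighborhood `U` of `F`. -/
theorem exists_isOpen_pi_subset {X ι : Type*} [TopologicalSpace X] [Finite ι] {F : Set X}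
    (hF : F.Finite) {G : Set (ι → X)} (hG : IsOpen G) (hFG : {v : ι → X | ∀ i, v i ∈ F} ⊆ G) :
    ∃ U, IsOpen U ∧ F ⊆ U ∧ {v : ι → X | ∀ i, v i ∈ U} ⊆ G := by
  have hpi : {v : ι → X | ∀ i, v i ∈ F}.Finite := by
    simpa [Set.pi] using! Set.Finite.pi' (fun _ : ι => hF)
  have hbox : ∀ v : ι → X, ∃ B : ι → Set X, (∀ i, IsOpen (B i) ∧ v i ∈ B i) ∧
      ((∀ i, v i ∈ F) → univ.pi B ⊆ G) := by
    intro v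
    by_cases hv : ∀ i, v i ∈ F
    · obtain ⟨B, hB, hBG⟩ := isOpen_pi_iff'.1 hG v (hFG hv)
      exact ⟨B, hB, fun _ => hBG⟩
    · exact ⟨fun _ => univ, fun _ => ⟨isOpen_univ, mem_univ _⟩, fun h => (hv h).elim⟩
  choose B hB hBG using hbox
  refine ⟨⋃ a ∈ F, ⋂ v ∈ {v : ι → X | ∀ i, v i ∈ F}, ⋂ i, ⋂ _ : v i = a, B v i, ?_, ?_, ?_⟩
  · refine isOpen_biUnion fun a _ => hpi.isOpen_biInter fun v _ => ?_
    exact isOpen_iInter_of_finite fun i => isOpen_iInter_of_finite fun _ => (hB v i).1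
  · intro a ha
    refine mem_iUnion₂.2 ⟨a, ha, mem_iInter₂.2 fun v _ => mem_iInter₂.2 ?_⟩
    rintro i rfl
    exact (hB v i).2
  · intro u hu
    choose a ha hua using fun i => mem_iUnion₂.1 (hu i)
    exact hBG a ha fun i _ => mem_iInter₂.1 (mem_iInter₂.1 (hua i) a ha) i rfl

variable (X : Type*) [TopologicalSpace X]

theorem isRothberger_finitePowers [Nonempty X]
    (h : RothbergerOn (univ : Set (UpperVietoris (finiteSets X)))) :
    IsRothberger (FinitePowers X) := by
  have : Nonempty (FinitePowers X) := ⟨⟨1, fun _ => Classical.arbitrary X⟩⟩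
  rw [isRothberger_iff]
  let Φ : ℕ → UpperVietoris (finiteSets X) → Set (FinitePowers X) := fun k F =>
    Sigma.mk k.succPNat '' {v | ∀ i, v i ∈ F.1}
  have hΦ : ∀ k, RothbergerOn (⋃ F, Φ k F) := by
    intro k
    refine h.iUnion_of_finite (fun F => ?_) (fun F G hG hFG => ?_) ?_
    · refine Set.Finite.image _ ?_
      simpa [Set.pi] using! Set.Finite.pi' (fun _ : Fin k.succPNat => F.2.1)
    · obtain ⟨U, hU, hFU, hUG⟩ := exists_isOpen_pi_subset F.2.1
        (isOpen_sigma_iff.1 hG k.succPNat) (image_subset_iff.1 hFG)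
      filter_upwards [(UpperVietoris.isOpen_setOf_subset hU).mem_nhds hFU] with F' hF'
      exact image_subset_iff.2 fun v hv => hUG fun i => hF' (hv i)
    · exact ⟨⟨k.succPNat, fun _ => Classical.arbitrary X⟩, mem_iUnion.2
        ⟨⟨{Classical.arbitrary X}, finite_singleton _, singleton_nonempty _⟩, _,
          fun _ => rfl, rfl⟩⟩
  have huniv : (⋃ k, ⋃ F, Φ k F) = univ := by
    refine eq_univ_of_forall ?_
    rintro ⟨n, v⟩
    obtain ⟨k, rfl⟩ : ∃ k : ℕ, k.succPNat = n := ⟨n.natPred, n.succPNat_natPred⟩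
    have : Nonempty (Fin k.succPNat) := ⟨⟨0, k.succPNat.pos⟩⟩
    exact mem_iUnion₂.2 ⟨k, ⟨range v, finite_range v, range_nonempty v⟩, v,
      fun i => mem_range_self i, rfl⟩
  rw [← huniv]
  exact .iUnion hΦ

theorem isRothberger_pFin [Nonempty X] (h : IsRothberger (FinitePowers X)) :
    IsRothberger (PFin X) := by
  have : Nonempty (FinitePowers X) := ⟨⟨1, fun _ => Classical.arbitrary X⟩⟩
  have : Nonempty (PFin X) := ⟨⟨{Classical.arbitrary X}, by simp⟩⟩
  rw [isRothberger_iff] at h ⊢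
  have hne : ∀ p : FinitePowers X, Nonempty (Fin p.1) := fun p => ⟨⟨0, p.1.pos⟩⟩
  let f : FinitePowers X → PFin X := fun p =>
    ⟨⟨⟨range p.2, (finite_range p.2).isCompact⟩, have := hne p; range_nonempty p.2⟩,
      finite_range p.2⟩
  refine h.of_surjective (f := f) (Continuous.subtype_mk ?_ _) ?_
  · let _ : TopologicalSpace (Set X) := .vietoris X
    rw [NonemptyCompacts.isEmbedding_coe.continuous_iff]
    exact continuous_sigma fun n => vietoris.continuous_range_of_finite
  · rintro ⟨K, hK⟩
    have hc : 0 < hK.toFinset.card :=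
      Finset.card_pos.2 (by simpa using K.nonempty)
    let e := hK.toFinset.equivFin
    refine ⟨⟨⟨_, hc⟩, fun i => (e.symm i).1⟩, Subtype.ext (NonemptyCompacts.ext ?_)⟩
    change range (fun i => (e.symm i).1) = (K : Set X)
    rw [show (fun i => (e.symm i).1) = Subtype.val ∘ e.symm from rfl, e.symm.surjective.range_comp]
    simp

theorem rothbergerOn_upperVietoris_finiteSets [Nonempty X] (h : IsRothberger (PFin X)) :
    RothbergerOn (univ : Set (UpperVietoris (finiteSets X))) := by
  have : Nonempty (PFin X) := ⟨⟨{Classical.arbitrary X}, by simp⟩⟩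
  rw [isRothberger_iff] at h
  refine h.of_surjective (f := fun K => ⟨K.1, K.2, K.1.nonempty⟩) ?_ ?_
  · refine ⟨fun S hS => isOpen_iff_mem_nhds.2 fun K hK => ?_⟩
    obtain ⟨U, hU, hKU, hUS⟩ := hS _ hK
    exact mem_of_superset (((NonemptyCompacts.isOpen_subsets_of_isOpen hU).preimage
      continuous_subtype_val).mem_nhds hKU) fun K' hK' => hUS _ hK'
  · rintro ⟨F, hF, hne⟩
    exact ⟨⟨⟨⟨F, hF.isCompact⟩, hne⟩, hF⟩, rfl⟩

end FinitePowers

/-! ### Minimal cusco maps with prescribed values -/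

section Cusco

variable {X : Type*}

theorem graph_subset_graph {Φ Ψ : X → NonemptyCompacts ℝ} :
    graph Φ ⊆ graph Ψ ↔ ∀ x, (Φ x : Set ℝ) ⊆ Ψ x :=
  ⟨fun h x _ ht => h (show (x, _) ∈ graph Φ from ht), fun h _ hp => h _ hp⟩

theorem graph_injective : Function.Injective (graph : (X → NonemptyCompacts ℝ) → Set (X × ℝ)) :=
  fun _ _ h => funext fun x => NonemptyCompacts.ext <|
    (graph_subset_graph.1 h.le x).antisymm (graph_subset_graph.1 h.ge x)

variable [TopologicalSpace X]

theorem isCusco_iff {Φ : X → NonemptyCompacts ℝ} : IsCusco Φ ↔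
    (∀ x u, IsOpen u → (Φ x : Set ℝ) ⊆ u → ∀ᶠ x' in 𝓝 x, (Φ x' : Set ℝ) ⊆ u) ∧
      ∀ x, Convex ℝ (Φ x : Set ℝ) := by
  rw [IsCusco, upperHemicontinuous_iff_forall_isOpen]

theorem IsCusco.isOpen_setOf_subset {Φ : X → NonemptyCompacts ℝ} (hΦ : IsCusco Φ) {u : Set ℝ}
    (hu : IsOpen u) : IsOpen {x | (Φ x : Set ℝ) ⊆ u} :=
  isOpen_iff_mem_nhds.2 fun x hx => (isCusco_iff.1 hΦ).1 x u hu hx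

/-- Every cusco map contains a minimal one, by Zorn's lemma: the fiberwise intersection of a chain
of cusco maps is cusco by compactness of the values. -/
theorem IsCusco.exists_isMinimalCusco {Θ : X → NonemptyCompacts ℝ} (hΘ : IsCusco Θ) :
    ∃ Ψ, IsMinimalCusco Ψ ∧ ∀ x, (Ψ x : Set ℝ) ⊆ Θ x := by
  obtain ⟨m, ⟨⟨Ψ, hΨ, hΨΘ, rfl⟩, hmin⟩⟩ :=
    zorn_superset {g | ∃ Φ, IsCusco Φ ∧ graph Φ ⊆ graph Θ ∧ graph Φ = g} (by
      intro c hc hchain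
      rcases c.eq_empty_or_nonempty with rfl | hne
      · exact ⟨_, ⟨Θ, hΘ, subset_rfl, rfl⟩, by simp⟩
      have hne' : Nonempty c := hne.to_subtype
      choose Φ hΦ hΦΘ hΦg using fun g : c => hc g.2
      have hdir : ∀ x, Directed (· ⊇ ·) fun g => (Φ g x : Set ℝ) := by
        intro x g g'
        rcases hchain.total g.2 g'.2 with h | h
        · rw [← hΦg, ← hΦg] at h
          exact ⟨g, subset_rfl, graph_subset_graph.1 h x⟩
        · rw [← hΦg, ← hΦg] at h
          exact ⟨g', graph_subset_graph.1 h x, subset_rfl⟩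
      let N : X → NonemptyCompacts ℝ := fun x => ⟨⟨⋂ g, (Φ g x : Set ℝ),
        (Φ hne'.some x).isCompact.of_isClosed_subset
          (isClosed_iInter fun g => (Φ g x).isCompact.isClosed) (iInter_subset _ _)⟩,
        IsCompact.nonempty_iInter_of_directed_nonempty_isCompact_isClosed _ (hdir x)
          (fun g => (Φ g x).nonempty) (fun g => (Φ g x).isCompact)
          (fun g => (Φ g x).isCompact.isClosed)⟩
      have hN : ∀ g x, (N x : Set ℝ) ⊆ Φ g x := fun g x => iInter_subset _ g
      refine ⟨_, ⟨N, isCusco_iff.2 ⟨fun x u hu hxu => ?_, fun x => ?_⟩, ?_, rfl⟩, fun g hg => ?_⟩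
      · obtain ⟨g, hg⟩ := exists_subset_nhds_of_isCompact' (hdir x)
          (fun g => (Φ g x).isCompact) (fun g => (Φ g x).isCompact.isClosed)
          (fun t ht => hu.mem_nhds (hxu ht))
        filter_upwards [(isCusco_iff.1 (hΦ g)).1 x u hu hg] with x' hx'
        exact (hN g x').trans hx'
      · exact convex_iInter fun g => (hΦ g).2 x
      · exact graph_subset_graph.2 fun x => (hN hne'.some x).trans
          (graph_subset_graph.1 (hΦΘ hne'.some) x)
      · exact (graph_subset_graph.2 (hN ⟨g, hg⟩)).trans (hΦg ⟨g, hg⟩).le)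
  exact ⟨Ψ, ⟨hΨ, fun Φ hΦ h => h.antisymm (hmin ⟨Φ, hΦ, h.trans hΨΘ, rfl⟩ h)⟩,
    graph_subset_graph.1 hΨΘ⟩

/-- A minimal cusco map is minimal on each open set. -/
theorem IsMinimalCusco.eq_of_subset {Φ Ψ : X → NonemptyCompacts ℝ} (hΦ : IsMinimalCusco Φ)
    (hΨ : IsCusco Ψ) {V : Set X} (hV : IsOpen V) (h : ∀ x ∈ V, (Ψ x : Set ℝ) ⊆ Φ x) :
    ∀ x ∈ V, Ψ x = Φ x := by
  classical
  have hsub : ∀ x, ((if x ∈ V then Ψ x else Φ x : NonemptyCompacts ℝ) : Set ℝ) ⊆ Φ x := by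
    intro x
    split_ifs with hx
    · exact h x hx
    · exact subset_rfl
  have key := graph_injective (hΦ.2 (fun x => if x ∈ V then Ψ x else Φ x)
    (isCusco_iff.2 ⟨fun x u hu hxu => ?_, fun x => ?_⟩) (graph_subset_graph.2 hsub))
  · intro x hx
    simpa [hx] using congrFun key x
  · by_cases hx : x ∈ V
    · rw [if_pos hx] at hxu
      filter_upwards [hV.mem_nhds hx, (isCusco_iff.1 hΨ).1 x u hu hxu] with x' h1 h2
      rwa [if_pos h1]
    · rw [if_neg hx] at hxu
      filter_upwards [(isCusco_iff.1 hΦ.1).1 x u hu hxu] with x' h'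
      exact (hsub x').trans h'
  · split_ifs
    · exact hΨ.2 x
    · exact hΦ.1.2 x

/-- A minimal cusco map can be changed to a constant outside a neighborhood `U` of a compact
set `A`. Take an open `V` with `A ⊆ V ⊆ closure V ⊆ U`, and a minimal cusco map contained in the
cusco map that agrees with `Φ` on `V`, is `{c}` off `closure V`, and has the closed convex hull of
`Φ x` and `c` as its value at the points `x` of the boundary. -/
theorem IsMinimalCusco.exists_eq_on_eq_const [RegularSpace X] {Φ : X → NonemptyCompacts ℝ}
    (hΦ : IsMinimalCusco Φ) {A U : Set X} (hA : IsCompact A) (hU : IsOpen U) (hAU : A ⊆ U) (c : ℝ) :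
    ∃ Ψ, IsMinimalCusco Ψ ∧ (∀ x ∈ A, Ψ x = Φ x) ∧ ∀ x ∉ U, Ψ x = {c} := by
  classical
  obtain ⟨V, hV, hAV, hVU⟩ := hA.exists_isOpen_closure_subset (hU.mem_nhdsSet.2 hAU)
  let H : X → NonemptyCompacts ℝ := fun x => ⟨⟨closedConvexHull ℝ (insert c (Φ x : Set ℝ)),
    Metric.isCompact_of_isClosed_isBounded isClosed_closedConvexHull (by
      rw [closedConvexHull_eq_closure_convexHull]
      exact (isBounded_convexHull.2 ((Φ x).isCompact.insert c).isBounded).closure)⟩,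
    (insert_nonempty _ _).mono subset_closedConvexHull⟩
  have hcH : ∀ x, c ∈ (H x : Set ℝ) := fun x => subset_closedConvexHull (mem_insert _ _)
  have hΦH : ∀ x, (Φ x : Set ℝ) ⊆ H x := fun x =>
    (subset_insert _ _).trans (subset_closedConvexHull)
  let Θ : X → NonemptyCompacts ℝ := fun x =>
    if x ∈ V then Φ x else if x ∈ closure V then H x else {c}
  have hΘV : ∀ x ∈ V, Θ x = Φ x := fun x hx => if_pos hx
  have hΘH : ∀ x, (Θ x : Set ℝ) ⊆ H x := by
    intro x
    by_cases h1 : x ∈ V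
    · rw [hΘV x h1]
      exact hΦH x
    · by_cases h2 : x ∈ closure V
      · simp only [Θ, if_neg h1, if_pos h2]
        exact subset_rfl
      · simp only [Θ, if_neg h1, if_neg h2]
        simpa using hcH x
  have hΘc : ∀ x ∉ closure V, Θ x = {c} := fun x hx => by
    simp only [Θ, if_neg hx, if_neg fun h => hx (subset_closure h)]
  have hΘ : IsCusco Θ := by
    refine isCusco_iff.2 ⟨fun x u hu hxu => ?_, fun x => ?_⟩
    · by_cases h1 : x ∈ V
      · rw [hΘV x h1] at hxu
        filter_upwards [hV.mem_nhds h1, (isCusco_iff.1 hΦ.1).1 x u hu hxu] with x' h h'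
        rwa [hΘV x' h]
      · by_cases h2 : x ∈ closure V
        · have hx : Θ x = H x := by simp only [Θ, if_neg h1, if_pos h2]
          rw [hx] at hxu
          -- The closed thickenings of the convex set `H x` are convex neighborhoods of it.
          obtain ⟨ε, hε, hεu⟩ := (H x).isCompact.exists_cthickening_subset_open hu hxu
          have hHx := Metric.self_subset_thickening hε (H x : Set ℝ)
          have hth := Metric.thickening_subset_cthickening ε (H x : Set ℝ)
          have hconv : Convex ℝ (Metric.cthickening ε (H x : Set ℝ)) :=
            convex_closedConvexHull.cthickening ε
          filter_upwards [(isCusco_iff.1 hΦ.1).1 x _ Metric.isOpen_thickening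
            ((hΦH x).trans hHx)] with x' hx'
          refine (hΘH x').trans (Subset.trans ?_ hεu)
          exact closedConvexHull_min (insert_subset (hth (hHx (hcH x))) (hx'.trans hth)) hconv
            Metric.isClosed_cthickening
        · rw [hΘc x h2] at hxu
          filter_upwards [isClosed_closure.isOpen_compl.mem_nhds h2] with x' h'
          rwa [hΘc x' h']
    · simp only [Θ]
      split_ifs
      · exact hΦ.1.2 x
      · exact convex_closedConvexHull
      · simp
  obtain ⟨Ψ, hΨ, hΨΘ⟩ := hΘ.exists_isMinimalCusco
  refine ⟨Ψ, hΨ, fun x hx => hΦ.eq_of_subset hΨ.1 hV (fun y hy => ?_) x (hAV hx), fun x hx => ?_⟩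
  · rw [← hΘV y hy]
    exact hΨΘ y
  · have h := hΨΘ x
    rw [hΘc x fun h => hx (hVU h)] at h
    exact NonemptyCompacts.ext ((subset_singleton_iff_eq.1 h).resolve_left (Ψ x).nonempty.ne_empty)

theorem isMinimalCusco_const (c : ℝ) : IsMinimalCusco fun _ : X => ({c} : NonemptyCompacts ℝ) := by
  refine ⟨⟨UpperHemicontinuous.const, fun x => by simp⟩, fun Ψ _ h => ?_⟩
  congr 1
  funext x
  exact NonemptyCompacts.ext ((subset_singleton_iff_eq.1 (graph_subset_graph.1 h x)).resolve_left
    (Ψ x).nonempty.ne_empty)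

theorem IsCusco.exists_bound {Φ : X → NonemptyCompacts ℝ} (hΦ : IsCusco Φ) {A : Set X}
    (hA : IsCompact A) : ∃ M : ℕ, ∀ x ∈ A, ∀ t ∈ Φ x, |t| < M := by
  obtain ⟨M, hM⟩ := hA.elim_directed_cover (fun M : ℕ => {x | (Φ x : Set ℝ) ⊆ Metric.ball 0 M})
    (fun M => hΦ.isOpen_setOf_subset Metric.isOpen_ball)
    (by
      intro x _
      obtain ⟨r, hr⟩ := (Φ x).isCompact.isBounded.subset_ball 0
      obtain ⟨M, hM⟩ := exists_nat_ge r
      exact mem_iUnion.2 ⟨M, hr.trans (Metric.ball_subset_ball hM)⟩)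
    (Monotone.directed_le fun M M' h x hx =>
      hx.trans (Metric.ball_subset_ball (Nat.cast_le.2 h)))
  exact ⟨M, fun x hx t ht => by simpa using hM hx ht⟩

end Cusco

/-! ### The spaces of minimal cusco maps -/

theorem exists_abs_sub_lt_of_dist_lt {K L : NonemptyCompacts ℝ} {ε : ℝ} (h : dist K L < ε) {t : ℝ}
    (ht : t ∈ K) : ∃ s ∈ L, |t - s| < ε := by
  rw [Metric.NonemptyCompacts.dist_eq] at h
  exact Metric.exists_dist_lt_of_hausdorffDist_lt ht h
    (Metric.hausdorffEDist_ne_top_of_nonempty_of_bounded K.nonempty L.nonempty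
      K.isCompact.isBounded L.isCompact.isBounded)

theorem subset_ball_of_dist_zero_lt {K : NonemptyCompacts ℝ} {ε : ℝ} (h : dist K {0} < ε) :
    (K : Set ℝ) ⊆ Metric.ball 0 ε := by
  intro t ht
  obtain ⟨s, hs, hts⟩ := exists_abs_sub_lt_of_dist_lt h ht
  obtain rfl : s = 0 := by simpa using hs
  simpa using hts

theorem dist_zero_le_of_subset_ball {K : NonemptyCompacts ℝ} {ε : ℝ}
    (h : (K : Set ℝ) ⊆ Metric.ball 0 ε) : dist K {0} ≤ ε := by
  obtain ⟨t, ht⟩ := K.nonempty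
  have ht' := (Metric.mem_ball.1 (h ht)).le
  rw [Metric.NonemptyCompacts.dist_eq]
  refine Metric.hausdorffDist_le_of_mem_dist (dist_nonneg.trans ht')
    (fun s hs => ⟨0, by simp, (Metric.mem_ball.1 (h hs)).le⟩) fun s hs => ⟨t, ht, ?_⟩
  obtain rfl : s = 0 := by simpa using hs
  rwa [dist_comm]

theorem range_mem_closedDiscrete {Z : Type*} [TopologicalSpace Z] [T1Space Z] {z : ℕ → Z}
    (h : ∀ y, ∃ V ∈ 𝓝 y, {n | z n ∈ V}.Finite) : range z ∈ closedDiscrete Z := by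
  have hsub : ∀ S ⊆ range z, IsClosed S := by
    intro S hS
    refine isClosed_iff_nhds.2 fun y hy => ?_
    by_contra hyS
    obtain ⟨V, hV, hfin⟩ := h y
    have hF : (z '' {n | z n ∈ V} \ {y}).Finite := (hfin.image z).sdiff
    obtain ⟨w, ⟨hwV, hwF⟩, hwS⟩ := hy _ (inter_mem hV
      (hF.isClosed.isOpen_compl.mem_nhds fun hy => hy.2 rfl))
    obtain ⟨n, rfl⟩ := hS hwS
    exact hwF ⟨⟨n, hwV, rfl⟩, fun hwy => hyS (hwy ▸ hwS)⟩
  refine ⟨hsub _ subset_rfl, isDiscrete_iff_forall_mem_exists_isClosed.2 fun S hS => ?_⟩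
  exact ⟨S, hsub S hS, inter_eq_left.2 hS⟩

namespace MC

variable {X : Type*} [TopologicalSpace X] {𝒜 : Set (Set X)}

/-- The set-valued map underlying an element of `MC 𝒜`. -/
def map (Φ : MC 𝒜) : X → NonemptyCompacts ℝ := UniformOnFun.toFun 𝒜 Φ.1

theorem isMinimalCusco_map (Φ : MC 𝒜) : IsMinimalCusco Φ.map := Φ.2

theorem exists_map_eq {Φ : X → NonemptyCompacts ℝ} (hΦ : IsMinimalCusco Φ) :
    ∃ Ψ : MC 𝒜, Ψ.map = Φ := ⟨⟨UniformOnFun.ofFun 𝒜 Φ, hΦ⟩, rfl⟩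

theorem map_zero : (0 : MC 𝒜).map = fun _ => {0} := rfl

/-- The basic neighborhoods in the topology of uniform convergence on the members of `𝒜`. -/
theorem hasBasis_nhds [Nonempty X] (h𝒜 : IsCompactBase 𝒜) (Φ : MC 𝒜) :
    (𝓝 Φ).HasBasis (fun p : Set X × ℝ => p.1 ∈ 𝒜 ∧ 0 < p.2)
      fun p => {Ψ | ∀ x ∈ p.1, dist (Ψ.map x) (Φ.map x) < p.2} := by
  have hΦ : 𝓝 Φ = comap Subtype.val (𝓝 Φ.1) := nhds_induced _ _
  rw [hΦ]
  exact (UniformOnFun.hasBasis_nhds_of_basis X (NonemptyCompacts ℝ) 𝒜 Φ.1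
    ⟨_, h𝒜.singleton_mem (Classical.arbitrary X)⟩
    (fun A hA B hB => ⟨_, h𝒜.union_mem A hA B hB, subset_union_left, subset_union_right⟩)
    Metric.uniformity_basis_dist).comap _

theorem t2Space (h𝒜 : IsCompactBase 𝒜) : T2Space (MC 𝒜) := by
  have : T2Space (UniformOnFun X (NonemptyCompacts ℝ) 𝒜) :=
    UniformOnFun.t2Space_of_covering (eq_univ_of_forall fun x => ⟨_, h𝒜.singleton_mem x, rfl⟩)
  infer_instance

/-- Every neighborhood of `0` contains a nonzero constant map. -/
theorem exists_ne_zero_mem [Nonempty X] (h𝒜 : IsCompactBase 𝒜) {U : Set (MC 𝒜)}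
    (hU : U ∈ 𝓝 (0 : MC 𝒜)) : ∃ Ψ ∈ U, Ψ ≠ 0 := by
  obtain ⟨⟨A, ε⟩, ⟨hA, hε⟩, hAU⟩ := (hasBasis_nhds h𝒜 _).mem_iff.1 hU
  obtain ⟨Ψ, hΨ⟩ := exists_map_eq (𝒜 := 𝒜) (isMinimalCusco_const (X := X) (ε / 2))
  refine ⟨Ψ, hAU fun x _ => ?_, fun h => ?_⟩
  · rw [hΨ, map_zero]
    refine (dist_zero_le_of_subset_ball (ε := 3 * ε / 4) ?_).trans_lt (by dsimp only; linarith)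
    simpa [abs_of_pos hε] using (by linarith : ε / 2 < 3 * ε / 4)
  · rw [h, map_zero] at hΨ
    have h0 : ε / 2 ∈ ({ε / 2} : NonemptyCompacts ℝ) := by simp
    rw [← congrFun hΨ (Classical.arbitrary X)] at h0
    have : ε / 2 = 0 := by simpa using h0
    exact (half_pos hε).ne' this

/-- Two beats every strategy of One in the game at `0`: an answer `Ψ` in inning `n` is seen as the
open set of the points `x` with `Ψ x ⊆ (-1/(n+1), 1/(n+1))`. -/
theorem not_oneWins_clusterSets [Nonempty X] (h𝒜 : IsCompactBase 𝒜)
    (h : RothbergerOn (univ : Set (UpperVietoris 𝒜))) :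
    ¬ OneWins (clusterSets (0 : MC 𝒜)) (clusterSets (0 : MC 𝒜)) := by
  rintro ⟨σ, hσ, hwin⟩
  have huniv : ∀ Ψ : MC 𝒜, Ψ ∈ ⋃₀ clusterSets (0 : MC 𝒜) := fun Ψ =>
    ⟨univ, by simp [clusterSets], mem_univ _⟩
  have hr : ∀ n : ℕ, (0 : ℝ) < 1 / ((n : ℝ) + 1) := fun n => Nat.one_div_pos_of_nat
  obtain ⟨Ψ, hΨ, hcov⟩ := h.exists_play (L := univ) (fun s => σ s.reverse)
    (fun n Ψ => {A | A.1 ⊆ {x | (Ψ.map x : Set ℝ) ⊆ Metric.ball 0 (1 / ((n : ℝ) + 1))}})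
    (fun _ _ => subset_univ _)
    (fun _ _ Ψ _ => UpperVietoris.isOpen_setOf_subset
      (Ψ.isMinimalCusco_map.1.isOpen_setOf_subset Metric.isOpen_ball))
    (fun s _ A => by
      have h0 : (0 : MC 𝒜) ∈ closure (σ s.reverse) := hσ _ fun Ψ _ => huniv Ψ
      obtain ⟨Ψ, hΨ, hΨσ⟩ := mem_closure_iff_nhds.1 h0 _
        ((hasBasis_nhds h𝒜 0).mem_of_mem (i := (A.1, 1 / ((s.length : ℝ) + 1))) ⟨A.2, hr _⟩)
      exact ⟨Ψ, hΨσ, fun x hx => subset_ball_of_dist_zero_lt (hΨ x hx)⟩)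
  refine hwin Ψ (fun n => by rw [← reverse_hist]; exact hΨ n) ?_
  refine mem_closure_iff_nhds.2 fun U hU => ?_
  obtain ⟨⟨A, ε⟩, ⟨hA, hε⟩, hAU⟩ := (hasBasis_nhds h𝒜 _).mem_iff.1 hU
  obtain ⟨n, hn, hnε⟩ := ((hcov ⟨A, hA⟩).and_eventually
    ((tendsto_one_div_add_atTop_nhds_zero_nat (𝕜 := ℝ)).eventually_lt_const hε)).exists
  exact ⟨Ψ n, hAU fun x hx => (dist_zero_le_of_subset_ball (hn hx)).trans_lt hnε, n, rfl⟩

theorem oneWins_clusterSets [Nonempty X] (h𝒜 : IsCompactBase 𝒜)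
    (h : TwoWins (pointNhds (0 : MC 𝒜)) (clusterSets (0 : MC 𝒜))ᶜ) :
    OneWins (clusterSets (0 : MC 𝒜)) (clusterSets (0 : MC 𝒜)) := by
  have := t2Space h𝒜
  refine h.oneWins fun f hf => mem_closure_iff_nhds.2 fun U hU => ?_
  obtain ⟨Φ, -, hΦ⟩ := exists_ne_zero_mem h𝒜 (univ_mem : univ ∈ 𝓝 (0 : MC 𝒜))
  -- Removing a nonzero point turns a neighborhood of `0` into a proper one.
  have hS : interior U \ {Φ} ∈ pointNhds (0 : MC 𝒜) := by
    have h0 : (0 : MC 𝒜) ∈ interior U \ {Φ} := ⟨mem_interior_iff_mem_nhds.2 hU, Ne.symm hΦ⟩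
    refine ⟨⟨isOpen_interior.sdiff isClosed_singleton, ⟨0, h0⟩, fun h => ?_⟩, h0⟩
    have hmem : Φ ∈ interior U \ {Φ} := h ▸ mem_univ Φ
    exact hmem.2 rfl
  exact ⟨_, interior_subset (hf _ hS).1, _, hS, rfl⟩

theorem twoWinsMarkov_pointNhds_of_not_strongFanTight (h : ¬ StrongFanTight (0 : MC 𝒜)) :
    TwoWinsMarkov (pointNhds (0 : MC 𝒜)) (clusterSets (0 : MC 𝒜))ᶜ :=
  .of_not_S1 (𝒜 := clusterSets (0 : MC 𝒜))
    (fun _ hA U hU => mem_closure_iff.1 hA U hU.1.1 hU.2) h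

theorem strongDenseFanTight_of_strongFanTight (h : StrongFanTight (0 : MC 𝒜)) :
    StrongDenseFanTight (0 : MC 𝒜) :=
  fun D hD => h D fun n => hD n 0

/-- For an `𝒜`-cover `𝒰`, the maps that are constantly `{1}` off some member of `𝒰` are dense. -/
theorem S1_coversOf_of_strongDenseFanTight [Nonempty X] [RegularSpace X] (h𝒜 : IsCompactBase 𝒜)
    (h : StrongDenseFanTight (0 : MC 𝒜)) : S1 (coversOf 𝒜) (coversOf 𝒜) := by
  intro 𝒰 h𝒰
  obtain ⟨Ψ, hΨ, hcl⟩ := h (fun n => {Ψ | ∃ U ∈ 𝒰 n, ∀ x ∉ U, Ψ.map x = {1}}) (by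
    intro n Φ
    refine mem_closure_iff_nhds.2 fun S hS => ?_
    obtain ⟨⟨A, ε⟩, ⟨hA, hε⟩, hAS⟩ := (hasBasis_nhds h𝒜 _).mem_iff.1 hS
    obtain ⟨U, hU, hAU⟩ := (h𝒰 n).2 A hA
    obtain ⟨Ψ, hΨ, hΨA, hΨU⟩ := Φ.isMinimalCusco_map.exists_eq_on_eq_const
      (h𝒜.isCompact A hA) ((h𝒰 n).1.1 U hU) hAU 1
    obtain ⟨Ψ, rfl⟩ := exists_map_eq (𝒜 := 𝒜) hΨ
    refine ⟨Ψ, hAS fun x hx => ?_, U, hU, hΨU⟩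
    rw [hΨA x hx, dist_self]
    exact hε)
  choose U hU hΨU using hΨ
  have hcov : ∀ A ∈ 𝒜, ∃ n, A ⊆ U n := by
    intro A hA
    obtain ⟨_, hΨ, n, rfl⟩ := mem_closure_iff_nhds.1 hcl _
      ((hasBasis_nhds h𝒜 0).mem_of_mem (i := (A, 1)) ⟨hA, one_pos⟩)
    refine ⟨n, fun x hx => ?_⟩
    by_contra hxU
    have h1 := subset_ball_of_dist_zero_lt (hΨ x hx)
    rw [hΨU n x hxU] at h1
    simp at h1
  exact ⟨U, hU, range_mem_coversOf h𝒜 h𝒰 hU hcov⟩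

/-- Given `𝒜`-covers `𝒰 n` without a good selection, Two answers an open set in inning `n` by one
of its members that is constantly `{n}` off some `U ∈ 𝒰 n`. As some member of `𝒜` is contained in
none of these `U`, and every cusco map is bounded on compact sets, the answers are locally
finite. -/
theorem twoWinsMarkov_closedDiscrete [Nonempty X] [RegularSpace X] (h𝒜 : IsCompactBase 𝒜)
    (h : ¬ S1 (coversOf 𝒜) (coversOf 𝒜)) :
    TwoWinsMarkov (properOpens (MC 𝒜)) (closedDiscrete (MC 𝒜)) := by
  have := t2Space h𝒜
  simp only [S1, not_forall, not_exists, not_and] at h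
  obtain ⟨𝒰, h𝒰, hno⟩ := h
  have hex : ∀ (S : Set (MC 𝒜)) (n : ℕ), ∃ Ψ : MC 𝒜, S ∈ properOpens (MC 𝒜) →
      Ψ ∈ S ∧ ∃ U ∈ 𝒰 n, ∀ x ∉ U, Ψ.map x = {(n : ℝ)} := by
    intro S n
    by_cases hS : S ∈ properOpens (MC 𝒜)
    · obtain ⟨Φ, hΦ⟩ := hS.2.1
      obtain ⟨⟨A, ε⟩, ⟨hA, hε⟩, hAS⟩ := (hasBasis_nhds h𝒜 _).mem_iff.1 (hS.1.mem_nhds hΦ)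
      obtain ⟨U, hU, hAU⟩ := (h𝒰 n).2 A hA
      obtain ⟨Ψ, hΨ, hΨA, hΨU⟩ := Φ.isMinimalCusco_map.exists_eq_on_eq_const
        (h𝒜.isCompact A hA) ((h𝒰 n).1.1 U hU) hAU n
      obtain ⟨Ψ, rfl⟩ := exists_map_eq (𝒜 := 𝒜) hΨ
      refine ⟨Ψ, fun _ => ⟨hAS fun x hx => ?_, U, hU, hΨU⟩⟩
      rw [hΨA x hx, dist_self]
      exact hε
    · exact ⟨0, fun h => (hS h).elim⟩
  choose τ hτ using hex
  refine ⟨τ, fun S hS => ⟨fun n => (hτ _ n (hS n)).1, ?_⟩⟩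
  choose U hU hτU using fun n => (hτ _ n (hS n)).2
  obtain ⟨A, hA, hAU⟩ : ∃ A ∈ 𝒜, ∀ n, ¬ A ⊆ U n := by
    by_contra! hcov
    exact hno U hU (range_mem_coversOf h𝒜 h𝒰 hU hcov)
  refine range_mem_closedDiscrete fun Φ => ?_
  obtain ⟨M, hM⟩ := Φ.isMinimalCusco_map.1.exists_bound (h𝒜.isCompact A hA)
  refine ⟨_, (hasBasis_nhds h𝒜 Φ).mem_of_mem (i := (A, 1)) ⟨hA, one_pos⟩,
    (finite_lt_nat (M + 1)).subset fun n hn => ?_⟩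
  obtain ⟨x, hxA, hxU⟩ := not_subset.1 (hAU n)
  have hd := hn x hxA
  dsimp only at hd
  rw [hτU n x hxU] at hd
  obtain ⟨s, hs, hns⟩ := exists_abs_sub_lt_of_dist_lt hd (t := n) (by simp)
  have h1 := hM x hxA s hs
  have h2 : (n : ℝ) < M + 1 := by
    have h3 := le_abs_self ((n : ℝ) - s)
    have h4 := le_abs_self s
    linarith
  exact_mod_cast h2

/-- Two plays the closed discrete game in the punctured neighborhoods of `0`. -/
theorem twoWins_pointNhds_of_closedDiscrete [Nonempty X] (h𝒜 : IsCompactBase 𝒜)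
    (h : TwoWins (properOpens (MC 𝒜)) (closedDiscrete (MC 𝒜))) :
    TwoWins (pointNhds (0 : MC 𝒜)) (clusterSets (0 : MC 𝒜))ᶜ := by
  have := t2Space h𝒜
  obtain ⟨τ, hτ⟩ := h
  refine ⟨fun s => τ (s.map (· \ {0})), fun U hU => ?_⟩
  have hU' : ∀ n, U n \ {0} ∈ properOpens (MC 𝒜) := fun n => by
    obtain ⟨Ψ, hΨ, hΨ0⟩ := exists_ne_zero_mem h𝒜 ((hU n).1.1.mem_nhds (hU n).2)
    refine ⟨(hU n).1.1.sdiff isClosed_singleton, ⟨Ψ, hΨ, hΨ0⟩, fun h => ?_⟩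
    have hmem : (0 : MC 𝒜) ∈ U n \ {0} := h ▸ mem_univ _
    exact hmem.2 rfl
  have hmap : ∀ n, (List.ofFn fun k : Fin (n + 1) => U k).map (· \ {0}) =
      List.ofFn fun k : Fin (n + 1) => U k \ {0} := fun n => by
    rw [List.map_ofFn]
    rfl
  simp only [hmap]
  obtain ⟨h1, h2⟩ := hτ _ hU'
  refine ⟨fun n => (h1 n).1, fun h0 => ?_⟩
  have h0' : (0 : MC 𝒜) ∈ closure _ := h0
  rw [h2.1.closure_eq] at h0'
  obtain ⟨n, hn⟩ := h0'
  exact (h1 n).2 hn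

end MC

/-! ### The equivalences -/

/-- The equivalences that hold for uniform convergence on the members of any family of nonempty
compact sets that contains the singletons and is closed under unions. -/
theorem tfae_S1_coversOf {X : Type*} [TopologicalSpace X] [RegularSpace X] [Nonempty X]
    {𝒜 : Set (Set X)} (h𝒜 : IsCompactBase 𝒜) : List.TFAE [
      S1 (coversOf 𝒜) (coversOf 𝒜),
      ¬ OneWins (coversOf 𝒜) (coversOf 𝒜),
      StrongFanTight (0 : MC 𝒜),
      StrongDenseFanTight (0 : MC 𝒜),
      ¬ TwoWinsMarkov (nhdsFamilies 𝒜) (coversOf 𝒜)ᶜ,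
      ¬ TwoWins (nhdsFamilies 𝒜) (coversOf 𝒜)ᶜ,
      ¬ TwoWinsMarkov (properOpens (MC 𝒜)) (closedDiscrete (MC 𝒜)),
      ¬ TwoWins (properOpens (MC 𝒜)) (closedDiscrete (MC 𝒜)),
      ¬ TwoWinsMarkov (pointNhds (0 : MC 𝒜)) (clusterSets (0 : MC 𝒜))ᶜ,
      ¬ TwoWins (pointNhds (0 : MC 𝒜)) (clusterSets (0 : MC 𝒜))ᶜ] := by
  tfae_have 1 → 2 := fun h => not_oneWins_coversOf h𝒜 (rothbergerOn_upperVietoris_of_S1 h𝒜 h)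
  tfae_have 2 → 6 := mt (oneWins_coversOf h𝒜)
  tfae_have 6 → 5 := mt TwoWinsMarkov.twoWins
  tfae_have 5 → 1 := fun h => not_not.1 (mt twoWinsMarkov_nhdsFamilies_of_not_S1 h)
  tfae_have 1 → 10 := fun h => mt (MC.oneWins_clusterSets h𝒜)
    (MC.not_oneWins_clusterSets h𝒜 (rothbergerOn_upperVietoris_of_S1 h𝒜 h))
  tfae_have 10 → 9 := mt TwoWinsMarkov.twoWins
  tfae_have 9 → 3 := fun h => not_not.1 (mt MC.twoWinsMarkov_pointNhds_of_not_strongFanTight h)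
  tfae_have 3 → 4 := MC.strongDenseFanTight_of_strongFanTight
  tfae_have 4 → 1 := MC.S1_coversOf_of_strongDenseFanTight h𝒜
  tfae_have 10 → 8 := mt (MC.twoWins_pointNhds_of_closedDiscrete h𝒜)
  tfae_have 8 → 7 := mt TwoWinsMarkov.twoWins
  tfae_have 7 → 1 := fun h => not_not.1 (mt (MC.twoWinsMarkov_closedDiscrete h𝒜) h)
  tfae_finish

theorem isOmegaRothberger_iff_rothbergerOn {X : Type*} [TopologicalSpace X] [Nonempty X] :
    IsOmegaRothberger X ↔ RothbergerOn (univ : Set (UpperVietoris (finiteSets X))) :=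
  ⟨rothbergerOn_upperVietoris_of_S1 (isCompactBase_finiteSets X),
    fun h => .of_not_oneWins (not_oneWins_coversOf (isCompactBase_finiteSets X) h)⟩

end SelectionGame

theorem mainTheorem7 (X : Type*) [TopologicalSpace X] [T2Space X] [RegularSpace X] [Nonempty X] :
    List.TFAE [
      IsOmegaRothberger X,
      IsRothberger (FinitePowers X),
      IsRothberger (PFin X),
      ¬ OneWins (omegaCovers X) (omegaCovers X),
      StrongFanTight (0 : MCp X),
      StrongDenseFanTight (0 : MCp X),
      ¬ TwoWinsMarkov (nhdsFamilies (finiteSets X)) (omegaCovers X)ᶜ,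
      ¬ TwoWins (nhdsFamilies (finiteSets X)) (omegaCovers X)ᶜ,
      ¬ TwoWinsMarkov (properOpens (MCp X)) (closedDiscrete (MCp X)),
      ¬ TwoWins (properOpens (MCp X)) (closedDiscrete (MCp X)),
      ¬ TwoWinsMarkov (pointNhds (0 : MCp X)) (clusterSets (0 : MCp X))ᶜ,
      ¬ TwoWins (pointNhds (0 : MCp X)) (clusterSets (0 : MCp X))ᶜ] ∧
    List.TFAE [
      IsKRothberger X,
      ¬ OneWins (kCovers X) (kCovers X),
      StrongFanTight (0 : MCk X),
      StrongDenseFanTight (0 : MCk X),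
      ¬ TwoWinsMarkov (nhdsFamilies (compactSets X)) (kCovers X)ᶜ,
      ¬ TwoWins (nhdsFamilies (compactSets X)) (kCovers X)ᶜ,
      ¬ TwoWinsMarkov (properOpens (MCk X)) (closedDiscrete (MCk X)),
      ¬ TwoWins (properOpens (MCk X)) (closedDiscrete (MCk X)),
      ¬ TwoWinsMarkov (pointNhds (0 : MCk X)) (clusterSets (0 : MCk X))ᶜ,
      ¬ TwoWins (pointNhds (0 : MCk X)) (clusterSets (0 : MCk X))ᶜ] := by
  refine ⟨?_, tfae_S1_coversOf (isCompactBase_compactSets X)⟩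
  have h := tfae_S1_coversOf (isCompactBase_finiteSets X)
  tfae_have 1 → 2 := fun h => isRothberger_finitePowers X (isOmegaRothberger_iff_rothbergerOn.1 h)
  tfae_have 2 → 3 := isRothberger_pFin X
  tfae_have 3 → 1 := fun h =>
    isOmegaRothberger_iff_rothbergerOn.2 (rothbergerOn_upperVietoris_finiteSets X h)
  tfae_have 1 ↔ 4 := h.out 0 1
  tfae_have 1 ↔ 5 := h.out 0 2
  tfae_have 1 ↔ 6 := h.out 0 3
  tfae_have 1 ↔ 7 := h.out 0 4
  tfae_have 1 ↔ 8 := h.out 0 5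
  tfae_have 1 ↔ 9 := h.out 0 6
  tfae_have 1 ↔ 10 := h.out 0 7
  tfae_have 1 ↔ 11 := h.out 0 8
  tfae_have 1 ↔ 12 := h.out 0 9
  tfae_finish
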